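/- All graphs are finite and simple. A graph is \emph{outerplanar} if it can be drawn without crossings in a closed disc with all its vertices on the boundary circle (equivalently, in the plane with all vertices on the boundary of the outer face). For a graph $F$, a graph is \emph{$F$-free} if it has no subgraph isomorphic to $F$. Let $\rho(G)$ be the largest modulus of an eigenvalue of the adjacency matrix of $G$, let $\mathrm{spex}_{\mathcal{OP}}(n,F)$ be the maximum of $\rho(G)$ over all $F$-free outerplanar graphs $G$ with $n$ vertices, and call an $F$-free outerplanar graph $G$ with $n$ vertices \emph{extremal} if $\rho(G)=\mathrm{spex}_{\mathcal{OP}}(n,F)$. Let $B_{tl}$ be the graph formed by $t$ cycles of length $l$ that share one common vertex and are otherwise vertex-disjoint. Write $P_m$ for the path with $m$ vertices ($P_0$ is the empty graph), $\cup$ for disjoint union, and $K_1\vee H$ for the graph obtained from $H$ by adding one new vertex adjacent to all vertices of $H$. For integers $n_1\ge n_2\ge 1$ with $n_1\le n-1$, put $q=\left\lfloor\frac{n-1-n_1}{n_2}\right\rfloor$ and $$H_{\mathcal{OP}}(n_1,n_2)=P_{n_1}\cup q\,P_{n_2}\cup P_{\,n-1-n_1-q n_2}.$$ \textbf{Theorem.}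 Let $l\ge 3$, $t\ge 1$ and $n\ge\max\{1.27\times 10^7,\ 6.5025\times 2^{(t-1)(l-1)+l}\}$ be integers. Then, up to isomorphism, there is exactly one extremal graph for $\mathrm{spex}_{\mathcal{OP}}(n,B_{tl})$, namely (i) $K_1\vee H_{\mathcal{OP}}(l-2,l-2)$ if $t=1$; (ii) $K_1\vee H_{\mathcal{OP}}(tl-t-1,l-2)$ if $t\ge 2$. -/

import Mathlib

open scoped ENNReal

namespace OuterplanarSpectral

/-- `S` is a simple arc in the plane with end points `a` and `b`: the image of an injective
continuous map from the unit interval that starts at `a` and ends at `b`. -/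
def IsSimpleArc (S : Set ℂ) (a b : ℂ) : Prop :=
  ∃ γ : unitInterval → ℂ, Continuous γ ∧ Function.Injective γ ∧ γ 0 = a ∧ γ 1 = b ∧
    Set.range γ = S

/-- A drawing of `G` without crossings in the closed unit disc of the plane, with all vertices on
the bounding circle. Edges are drawn as simple arcs in the disc; an arc contains no vertex other
than its two ends, and two arcs meet only in a common end vertex. The outside of the disc belongs
to the outer face, so every vertex lies on the boundary of the outer face. -/
structure OuterplanarDrawing {V : Type*} (G : SimpleGraph V) where
  /-- the position of a vertex -/
  pos : V → ℂ
  /-- the arc that represents an edge -/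
  arc : Sym2 V → Set ℂ
  pos_injective : Function.Injective pos
  pos_mem_sphere : ∀ v, pos v ∈ Metric.sphere (0 : ℂ) 1
  isSimpleArc : ∀ u v, G.Adj u v → IsSimpleArc (arc s(u, v)) (pos u) (pos v)
  arc_subset_closedBall : ∀ e ∈ G.edgeSet, arc e ⊆ Metric.closedBall (0 : ℂ) 1
  mem_of_pos_mem_arc : ∀ e ∈ G.edgeSet, ∀ v, pos v ∈ arc e → v ∈ e
  arc_inter_arc : ∀ e ∈ G.edgeSet, ∀ f ∈ G.edgeSet, e ≠ f →
    arc e ∩ arc f ⊆ pos '' {v | v ∈ e ∧ v ∈ f}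

/-- A graph is outerplanar if it can be drawn in a closed disc without crossings and with all
vertices on the boundary circle of the disc. -/
def IsOuterplanar {V : Type*} (G : SimpleGraph V) : Prop :=
  Nonempty (OuterplanarDrawing G)

open Classical in
/-- The spectral radius of a finite graph: the largest modulus of an eigenvalue of its adjacency
matrix (a real symmetric matrix, so that all its eigenvalues are real). -/
noncomputable def rho {V : Type*} [Fintype V] (G : SimpleGraph V) : ℝ≥0∞ :=
  spectralRadius ℝ (G.adjMatrix ℝ)

/-- The maximum of the spectral radius over all `F`-free outerplanar graphs with `n` vertices. -/
noncomputable def spexOP {W : Type*} (n : ℕ) (F : SimpleGraph W) : ℝ≥0∞ :=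
  ⨆ G ∈ {G : SimpleGraph (Fin n) | IsOuterplanar G ∧ F.Free G}, rho G

/-- The extremal graphs: the `F`-free outerplanar graphs with `n` vertices whose spectral radius
is `spexOP n F`. -/
def extremalOP {W : Type*} (n : ℕ) (F : SimpleGraph W) : Set (SimpleGraph (Fin n)) :=
  {G | IsOuterplanar G ∧ F.Free G ∧ rho G = spexOP n F}

/-- The join `G ∨ H`: disjoint copies of `G` and `H` and all edges between them. -/
def join {V W : Type*} (G : SimpleGraph V) (H : SimpleGraph W) : SimpleGraph (V ⊕ W) :=
  (G ⊕g H) ⊔ completeBipartiteGraph V W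

/-- The graph `B_{tl}`: `t` cycles of length `l` that have the vertex `none` in common and are
otherwise vertex-disjoint. The `i`-th cycle visits `none`, `(i, 0)`, `(i, 1)`, …, `(i, l - 2)` in
this order and then returns to `none`. -/
def cycleBouquet (t l : ℕ) : SimpleGraph (Option (Fin t × Fin (l - 1))) :=
  SimpleGraph.fromRel fun x y =>
    match x, y with
    | none, some (_, j) => (j : ℕ) = 0 ∨ (j : ℕ) + 1 = l - 1
    | some (i, j), some (i', j') => i = i' ∧ (j : ℕ) + 1 = j'
    | _, _ => False

/-- `k` disjoint copies of the path with `m` vertices. -/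
def pathCopies (k m : ℕ) : SimpleGraph (Fin k × Fin m) :=
  (⊥ : SimpleGraph (Fin k)) □ SimpleGraph.pathGraph m

/-- The graph `H_OP(n₁, n₂)` on `n - 1` vertices (for `1 ≤ n₂` and `n₁ ≤ n - 1`): a path with `n₁`
vertices, `⌊(n - 1 - n₁) / n₂⌋` paths with `n₂` vertices, and one path on the
`(n - 1 - n₁) mod n₂` vertices that are left over (no further path if this number is `0`). -/
def graphHOP (n n₁ n₂ : ℕ) :
    SimpleGraph ((Fin n₁ ⊕ Fin ((n - 1 - n₁) / n₂) × Fin n₂) ⊕ Fin ((n - 1 - n₁) % n₂)) :=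
  SimpleGraph.pathGraph n₁ ⊕g pathCopies ((n - 1 - n₁) / n₂) n₂ ⊕g
    SimpleGraph.pathGraph ((n - 1 - n₁) % n₂)

end OuterplanarSpectral

/-!
# Extremal outerplanar graphs without a bouquet of cycles

*From drawings to orders.* Two arcs in a closed disc whose ends interleave on the boundary circle
meet (`arcs_meet`): otherwise the difference of the two arcs has a continuous logarithm on the unit
square, but its argument decreases along each of the four sides. Hence the order of the vertices on
the circle, cut open just behind any chosen vertex, is non-crossing (`NonCrossing`), and conversely
straight chords turn a non-crossing order into a drawing. Everything else uses only such orders: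
they give at most `2k` edges on `k` vertices and the absence of `K_{2,3}`.

*A dominating vertex.* Let `x` be a Perron vector of an extremal graph `G`, scaled to have maximum
`x u = 1`, and `r ≥ √(n - 1)` the spectral radius (the star is a competitor). Counting walks of
length two shows that `u` has `n - O(r)` neighbours, then that all other weights are `O(1 / r)`, and
then that a vertex `v ≠ u` not adjacent to `u` has neighbours of total weight less than `1`
(`NonCrossing.neighborSum_lt_one`). Replacing all edges at `v` by the single edge `uv` would then
increase the spectral radius, and it creates no bouquet of cycles, since a pendant edge lies on no
cycle. So `u` is adjacent to all vertices, and every other edge joins consecutive vertices of the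
order: `G` is the join of `u` and a linear forest with paths of orders `m i` (a *cone*).

*The optimal linear forest.* A cone contains `t` cycles of length `l` through a common vertex if and
only if `t ≤ ∑ i, m i / (l - 1)` with rounded quotients (`free_cone_iff`). With `r = τ + τ⁻¹`, the
eigenvalue equation on a path is a linear recurrence with constant coefficients. Solving it shows
that, for a fixed total order and a fixed number of possibly empty paths, the spectral radius grows
with `∑ i, f (m i)`, where `f s = τ ^ s / (1 + τ ^ (s + 1))` (`sum_pathGain_le_of_rho_le`). As
`2 * f (s + 1) < f s`, moving vertices from a shorter path to a longer one increases this sum. If no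
such move respects `∑ i, m i / (l - 1) < t`, then one path has order `t * (l - 1) - 1` and all others
have order `l - 2`, with one exception at most (`exists_sizes_of_optimal`).
-/

/-! ### Crossing arcs in the disc -/

namespace OuterplanarSpectral

open Complex unitInterval ComplexConjugate

/-- A non-vanishing continuous function on the unit square has a continuous logarithm. -/
theorem exists_continuous_log (f : C(I × I, ℂ)) (hf : ∀ p, f p ≠ 0) :
    ∃ g : C(I × I, ℂ), ∀ p, exp (g p) = f p := by
  -- Pulled back to the plane, which Mathlib knows to be simply connected and locally path connected.
  let r : C(ℝ × ℝ, I × I) :=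
    ⟨fun p => (Set.projIcc 0 1 zero_le_one p.1, Set.projIcc 0 1 zero_le_one p.2),
      (continuous_projIcc.comp continuous_fst).prodMk (continuous_projIcc.comp continuous_snd)⟩
  obtain ⟨g, ⟨-, hg⟩, -⟩ := isCoveringMapOn_exp.existsUnique_continuousMap_lifts (f.comp r)
    (a₀ := (0, 0)) (e₀ := log (f (r (0, 0)))) (exp_log (hf _)) (by simpa using fun a b => hf _)
  refine ⟨⟨fun p => g (p.1, p.2), by fun_prop⟩, fun p => ?_⟩
  have h := congrFun hg (p.1, p.2)
  simpa [r] using h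

/-- Along a curve whose exponential stays in an open half-plane, the argument varies by less than
`π`; hence the orientation of the end points of `exp ∘ h` determines the sign of the variation. -/
theorem im_lt_of_halfPlane (h : C(I, ℂ)) (w : ℂ) (hw : w ≠ 0)
    (hpos : ∀ s, 0 < (exp (h s) * w).re)
    (hneg : (exp (h 1) * conj (exp (h 0))).im < 0) : (h 1).im < (h 0).im := by
  have key : ∀ s, 0 < Real.cos ((h s).im + w.arg) := by
    intro s
    have h1 : exp (h s) * w = exp (h s + log w) := by rw [exp_add, exp_log hw]
    have h2 := hpos s
    rw [h1, exp_re] at h2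
    simpa [log_im] using (pos_iff_pos_of_mul_pos h2).1 (Real.exp_pos _)
  have hcont : Continuous fun s => (h s).im := by fun_prop
  have hs : (exp (h 1) * conj (exp (h 0))).im
      = Real.exp ((h 1).re + (h 0).re) * Real.sin ((h 1).im - (h 0).im) := by
    rw [← exp_conj, ← exp_add, exp_im]; simp [sub_eq_add_neg]
  rw [hs] at hneg
  have hsin : Real.sin ((h 1).im - (h 0).im) < 0 := by
    by_contra hcon
    push Not at hcon
    exact absurd hneg (not_lt.2 (mul_nonneg (Real.exp_pos _).le hcon))
  by_contra hle
  push Not at hle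
  have hpi : Real.pi < (h 1).im - (h 0).im := by
    by_contra hcon
    push Not at hcon
    exact absurd hsin (not_lt.2 (Real.sin_nonneg_of_nonneg_of_le_pi (by linarith) hcon))
  obtain ⟨s, hs'⟩ := intermediate_value_univ (0 : I) 1 hcont
    ⟨show (h 0).im ≤ (h 0).im + Real.pi by linarith [Real.pi_pos], by linarith⟩
  have h3 := key s
  simp only at hs'
  rw [hs', add_right_comm, Real.cos_add_pi] at h3
  linarith [key 0]

/-- Seen from a point `p` of the unit circle, all other points of the closed disc lie in one open
half-plane. -/
theorem re_sub_mul_conj_pos {p z : ℂ} (hp : ‖p‖ = 1) (hz : ‖z‖ ≤ 1) (hne : p ≠ z) :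
    0 < ((p - z) * conj p).re := by
  have h1 : normSq p = 1 := by rw [normSq_eq_norm_sq, hp]; norm_num
  have h2 : normSq z ≤ 1 := by rw [normSq_eq_norm_sq]; nlinarith [norm_nonneg z]
  have h3 : 0 < normSq (p - z) := normSq_pos.2 (sub_ne_zero.2 hne)
  simp only [normSq_apply, sub_re, sub_im, mul_re, conj_re, conj_im] at *
  nlinarith

/-- Two arcs in the closed unit disc whose ends interleave on the bounding circle meet. The four
orientation hypotheses say that `a, b, c, d` is the counterclockwise order. -/
theorem arcs_meet {a b c d : ℂ} (ha : ‖a‖ = 1) (hb : ‖b‖ = 1) (hc : ‖c‖ = 1) (hd : ‖d‖ = 1)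
    (habc : ((c - b) * conj (a - b)).im < 0) (hbcd : ((d - c) * conj (b - c)).im < 0)
    (hcda : ((a - d) * conj (c - d)).im < 0) (hdab : ((b - a) * conj (d - a)).im < 0)
    (γ δ : C(I, ℂ)) (hγ : ∀ s, ‖γ s‖ ≤ 1) (hδ : ∀ s, ‖δ s‖ ≤ 1)
    (γ0 : γ 0 = a) (γ1 : γ 1 = c) (δ0 : δ 0 = b) (δ1 : δ 1 = d) : ∃ s t, γ s = δ t := by
  by_contra! hcon
  -- A logarithm of `γ s - δ t` would have to decrease its argument along all four sides of the
  -- unit square, traversed in circular order.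
  obtain ⟨g, hg⟩ := exists_continuous_log ⟨fun p => γ p.1 - δ p.2, by fun_prop⟩
    (fun p => sub_ne_zero.2 (hcon _ _))
  simp only [ContinuousMap.coe_mk] at hg
  have nz : ∀ {p : ℂ}, ‖p‖ = 1 → p ≠ 0 := by rintro p hp rfl; simp at hp
  have nz' : ∀ {p : ℂ}, ‖p‖ = 1 → conj p ≠ 0 := fun hp => by simpa using nz hp
  have e1 := im_lt_of_halfPlane ⟨fun s => g (s, 0), by fun_prop⟩ (-conj b) (by simpa using nz hb)
    (fun s => by
      have := re_sub_mul_conj_pos hb (hγ s) (by rw [← δ0]; exact (hcon s 0).symm)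
      simp only [ContinuousMap.coe_mk, hg, δ0]
      rwa [show (γ s - b) * -conj b = (b - γ s) * conj b by ring])
    (by simpa only [ContinuousMap.coe_mk, hg, δ0, γ0, γ1] using habc)
  have e2 := im_lt_of_halfPlane ⟨fun t => g (1, t), by fun_prop⟩ (conj c) (nz' hc)
    (fun t => by
      have := re_sub_mul_conj_pos hc (hδ t) (by rw [← γ1]; exact hcon 1 t)
      simpa only [ContinuousMap.coe_mk, hg, γ1])
    (by simpa only [ContinuousMap.coe_mk, hg, δ0, δ1, γ1, ← neg_sub c, map_neg, neg_mul_neg]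
      using hbcd)
  have e3 := im_lt_of_halfPlane ⟨fun s => g (σ s, 1), by fun_prop⟩ (-conj d)
    (by simpa using nz hd)
    (fun s => by
      have := re_sub_mul_conj_pos hd (hγ (σ s)) (by rw [← δ1]; exact (hcon _ 1).symm)
      simp only [ContinuousMap.coe_mk, hg, δ1]
      rwa [show (γ (σ s) - d) * -conj d = (d - γ (σ s)) * conj d by ring])
    (by simpa only [ContinuousMap.coe_mk, hg, δ1, γ0, γ1, symm_one, symm_zero] using hcda)
  have e4 := im_lt_of_halfPlane ⟨fun t => g (0, σ t), by fun_prop⟩ (conj a) (nz' ha)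
    (fun t => by
      have := re_sub_mul_conj_pos ha (hδ (σ t)) (by rw [← γ0]; exact hcon 0 _)
      simpa only [ContinuousMap.coe_mk, hg, γ0])
    (by simpa only [ContinuousMap.coe_mk, hg, δ0, δ1, γ0, symm_one, symm_zero, ← neg_sub a,
      map_neg, neg_mul_neg] using hdab)
  simp only [ContinuousMap.coe_mk, symm_one, symm_zero] at e1 e2 e3 e4
  linarith

theorem im_sub_mul_conj_cyclic (x y z : ℂ) :
    ((z - y) * conj (x - y)).im = ((x - z) * conj (y - z)).im := by
  simp only [map_sub, mul_im, sub_re, sub_im, conj_re, conj_im]; ring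

/-- Three points of the unit circle with increasing arguments are in counterclockwise order. -/
theorem orientation_of_arg_lt {x y z : ℝ} (h1 : x < y) (h2 : y < z)
    (h3 : z < x + 2 * Real.pi) :
    ((exp (z * Complex.I) - exp (y * Complex.I)) *
      conj (exp (x * Complex.I) - exp (y * Complex.I))).im < 0 := by
  have key : ((exp (z * Complex.I) - exp (y * Complex.I)) *
      conj (exp (x * Complex.I) - exp (y * Complex.I))).im
      = -(Real.sin (y - x) + Real.sin (z - y) - Real.sin ((y - x) + (z - y))) := by
    rw [show y - x + (z - y) = z - x by ring]
    simp only [map_sub, mul_im, sub_re, sub_im, conj_re, conj_im, exp_ofReal_mul_I_re,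
      exp_ofReal_mul_I_im, Real.sin_sub]
    ring
  have hp : 0 < Real.sin ((y - x) / 2) :=
    Real.sin_pos_of_pos_of_lt_pi (by linarith) (by linarith)
  have hq : 0 < Real.sin ((z - y) / 2) :=
    Real.sin_pos_of_pos_of_lt_pi (by linarith) (by linarith)
  have hpq : 0 < Real.sin ((y - x) / 2 + (z - y) / 2) :=
    Real.sin_pos_of_pos_of_lt_pi (by linarith) (by linarith)
  have half : ∀ p q : ℝ, Real.sin (2 * p) + Real.sin (2 * q) - Real.sin (2 * p + 2 * q)
      = 4 * (Real.sin p * Real.sin q * Real.sin (p + q)) := by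
    intro p q
    simp only [Real.sin_add, Real.sin_two_mul, Real.cos_two_mul']
    linear_combination -2 * Real.sin p * Real.cos p * Real.sin_sq_add_cos_sq q
      - 2 * Real.sin q * Real.cos q * Real.sin_sq_add_cos_sq p
  have := half ((y - x) / 2) ((z - y) / 2)
  rw [mul_div_cancel₀ _ two_ne_zero, mul_div_cancel₀ _ two_ne_zero] at this
  rw [key, this]
  have : 0 < 4 * (Real.sin ((y - x) / 2) * Real.sin ((z - y) / 2) *
    Real.sin ((y - x) / 2 + (z - y) / 2)) := by positivity
  linarith

/-- `G` has no crossing edges when the vertices are placed on a line in the order given by the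
injective map `θ` and the edges are drawn as arcs in a half-plane bounded by the line. -/
structure NonCrossing {V : Type*} (G : SimpleGraph V) (θ : V → ℝ) : Prop where
  injective : Function.Injective θ
  not_adj : ∀ a b c d, θ a < θ b → θ b < θ c → θ c < θ d → G.Adj a c → ¬ G.Adj b d

/-- The boundary circle of an outerplanar drawing can be cut open just behind any vertex. -/
theorem IsOuterplanar.exists_nonCrossing {V : Type*} {G : SimpleGraph V} (h : IsOuterplanar G)
    (u : V) : ∃ θ : V → ℝ, NonCrossing G θ ∧ ∀ v, v ≠ u → θ v < θ u := by
  obtain ⟨D⟩ := h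
  have hn : ∀ v, ‖D.pos v‖ = 1 := fun v => by simpa using D.pos_mem_sphere v
  -- rotate the drawing so that `u` has position `-1`, the point of largest argument
  set w : ℂ := -conj (D.pos u) with hw
  have hwn : ‖w‖ = 1 := by rw [hw, norm_neg, RCLike.norm_conj, hn]
  have hw0 : w ≠ 0 := by rintro h0; simp [h0] at hwn
  have hexp : ∀ v, exp ((w * D.pos v).arg * Complex.I) = w * D.pos v := fun v => by
    have := norm_mul_exp_arg_mul_I (w * D.pos v)
    rwa [norm_mul, hwn, hn, one_mul, ofReal_one, one_mul] at this
  have hinj : Function.Injective fun v => (w * D.pos v).arg := by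
    intro v v' hv
    have h1 := hexp v
    rw [show (w * D.pos v).arg = (w * D.pos v').arg from hv, hexp] at h1
    exact D.pos_injective (mul_left_cancel₀ hw0 h1.symm)
  have hu : (w * D.pos u).arg = Real.pi := by
    rw [hw, neg_mul, ← normSq_eq_conj_mul_self, normSq_eq_norm_sq, hn]; simp
  refine ⟨fun v => (w * D.pos v).arg, ⟨hinj, ?_⟩, fun v hv => ?_⟩
  · intro a b c d hab hbc hcd hac hbd
    obtain ⟨γ, hγ, -, γ0, γ1, hγr⟩ := D.isSimpleArc a c hac
    obtain ⟨δ, hδ, -, δ0, δ1, hδr⟩ := D.isSimpleArc b d hbd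
    have hd : (w * D.pos d).arg < (w * D.pos a).arg + 2 * Real.pi := by
      linarith [arg_le_pi (w * D.pos d), neg_pi_lt_arg (w * D.pos a)]
    have o : ∀ {x y z}, (w * D.pos x).arg < (w * D.pos y).arg →
        (w * D.pos y).arg < (w * D.pos z).arg →
        (w * D.pos z).arg < (w * D.pos x).arg + 2 * Real.pi →
        ((w * D.pos z - w * D.pos y) * conj (w * D.pos x - w * D.pos y)).im < 0 :=
      fun h1 h2 h3 => by simpa only [hexp] using orientation_of_arg_lt h1 h2 h3
    have hγc : ∀ s, ‖γ s‖ ≤ 1 := fun s => by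
      simpa using D.arc_subset_closedBall s(a, c) hac (hγr ▸ ⟨s, rfl⟩)
    have hδc : ∀ s, ‖δ s‖ ≤ 1 := fun s => by
      simpa using D.arc_subset_closedBall s(b, d) hbd (hδr ▸ ⟨s, rfl⟩)
    have hnw : ∀ v, ‖w * D.pos v‖ = 1 := fun v => by rw [norm_mul, hwn, hn, one_mul]
    obtain ⟨s, t, hst⟩ := arcs_meet (hnw a) (hnw b) (hnw c) (hnw d) (o hab hbc (by linarith))
      (o hbc hcd (by linarith))
      (by rw [im_sub_mul_conj_cyclic, im_sub_mul_conj_cyclic]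
          exact o (hab.trans hbc) hcd (by linarith))
      (by rw [im_sub_mul_conj_cyclic]
          exact o hab (hbc.trans hcd) (by linarith))
      ⟨fun s => w * γ s, by fun_prop⟩ ⟨fun s => w * δ s, by fun_prop⟩
      (fun s => by simpa [hwn] using hγc s) (fun s => by simpa [hwn] using hδc s)
      (by simp [γ0]) (by simp [γ1]) (by simp [δ0]) (by simp [δ1])
    have hst' : γ s = δ t := mul_left_cancel₀ hw0 hst
    have hne : s(a, c) ≠ s(b, d) := by
      intro he
      rcases Sym2.eq_iff.1 he with ⟨rfl, rfl⟩ | ⟨rfl, rfl⟩ <;> linarith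
    have hs : γ s ∈ D.arc s(a, c) := hγr ▸ ⟨s, rfl⟩
    have ht : γ s ∈ D.arc s(b, d) := hst' ▸ hδr ▸ ⟨t, rfl⟩
    obtain ⟨v, ⟨hv1, hv2⟩, -⟩ := D.arc_inter_arc s(a, c) hac s(b, d) hbd hne ⟨hs, ht⟩
    rcases Sym2.mem_iff.1 hv1 with rfl | rfl <;> rcases Sym2.mem_iff.1 hv2 with rfl | rfl <;>
      linarith
  · exact lt_of_le_of_ne (by simpa only [hu] using arg_le_pi _) fun he => hv (hinj he)

end OuterplanarSpectral

/-! ### Non-crossing vertex orders -/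

namespace OuterplanarSpectral

variable {V : Type*} {G : SimpleGraph V} {θ : V → ℝ}

/-- The rational parametrisation of the unit circle without the point `-1`. -/
noncomputable def circlePoint (s : ℝ) : ℂ := ⟨(1 - s ^ 2) / (1 + s ^ 2), 2 * s / (1 + s ^ 2)⟩

/-- An affine function that vanishes on the line through `circlePoint a` and `circlePoint c`. -/
noncomputable def chordForm (a c : ℝ) (z : ℂ) : ℝ :=
  (1 - z.re) - (a + c) * z.im + a * c * (1 + z.re)

theorem chordForm_circlePoint (a c s : ℝ) :
    chordForm a c (circlePoint s) = 2 / (1 + s ^ 2) * ((s - a) * (s - c)) := by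
  have : 1 + s ^ 2 ≠ 0 := by positivity
  simp only [chordForm, circlePoint]; field_simp; ring

theorem chordForm_lineMap (a c : ℝ) (z w : ℂ) (t : ℝ) :
    chordForm a c (AffineMap.lineMap z w t) = (1 - t) * chordForm a c z + t * chordForm a c w := by
  simp only [chordForm, AffineMap.lineMap_apply, vsub_eq_sub, vadd_eq_add, Complex.add_re,
    Complex.add_im, Complex.real_smul, Complex.mul_re, Complex.mul_im, Complex.sub_re,
    Complex.sub_im, Complex.ofReal_re, Complex.ofReal_im]
  ring

theorem chordForm_eq_zero {a c s : ℝ} (h : chordForm a c (circlePoint s) = 0) : s = a ∨ s = c := by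
  rw [chordForm_circlePoint] at h
  have h1 : (2 : ℝ) / (1 + s ^ 2) ≠ 0 := by positivity
  rcases mul_eq_zero.1 ((mul_eq_zero.1 h).resolve_left h1) with h | h
  · left; linarith
  · right; linarith

theorem chordForm_eq_zero_of_mem_segment {a c : ℝ} {z : ℂ}
    (hz : z ∈ segment ℝ (circlePoint a) (circlePoint c)) : chordForm a c z = 0 := by
  rw [segment_eq_image_lineMap] at hz
  obtain ⟨t, -, rfl⟩ := hz
  rw [chordForm_lineMap, chordForm_circlePoint, chordForm_circlePoint]; ring

theorem circlePoint_injective : Function.Injective circlePoint := by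
  intro s s' h
  have h1 : chordForm s s (circlePoint s') = 0 := by
    rw [← h, chordForm_circlePoint]; ring
  rcases chordForm_eq_zero h1 with h | h <;> exact h.symm

theorem norm_circlePoint (s : ℝ) : ‖circlePoint s‖ = 1 := by
  have h0 : 1 + s ^ 2 ≠ 0 := by positivity
  have h : Complex.normSq (circlePoint s) = 1 := by
    simp only [Complex.normSq_apply, circlePoint]; field_simp; ring
  rw [Complex.normSq_eq_norm_sq] at h
  nlinarith [norm_nonneg (circlePoint s)]

/-- The ends of an edge are not strictly separated by those of another edge. -/
theorem NonCrossing.separate_nonneg (h : NonCrossing G θ) {a b c d : V} (hac : G.Adj a c)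
    (hbd : G.Adj b d) :
    0 ≤ ((θ b - θ a) * (θ b - θ c)) * ((θ d - θ a) * (θ d - θ c)) := by
  have key : ∀ {a b c d}, G.Adj a c → G.Adj b d → (θ b - θ a) * (θ b - θ c) < 0 →
      0 < (θ d - θ a) * (θ d - θ c) → False := by
    intro a b c d hac hbd h1 h2
    rcases mul_neg_iff.1 h1 with ⟨h3, h4⟩ | ⟨h3, h4⟩ <;>
      rcases mul_pos_iff.1 h2 with ⟨h5, h6⟩ | ⟨h5, h6⟩
    · exact h.not_adj a b c d (by linarith) (by linarith) (by linarith) hac hbd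
    · exact h.not_adj d a b c (by linarith) (by linarith) (by linarith) hbd.symm hac
    · exact h.not_adj c b a d (by linarith) (by linarith) (by linarith) hac.symm hbd
    · exact h.not_adj d c b a (by linarith) (by linarith) (by linarith) hbd.symm hac.symm
  by_contra! hneg
  rcases mul_neg_iff.1 hneg with ⟨h1, h2⟩ | ⟨h1, h2⟩
  · exact key hac hbd.symm h2 h1
  · exact key hac hbd h1 h2

/-- A graph with a non-crossing vertex order is drawn on the disc with straight chords. -/
theorem NonCrossing.isOuterplanar (h : NonCrossing G θ) : IsOuterplanar G := by
  have hpos : Function.Injective fun v => circlePoint (θ v) :=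
    circlePoint_injective.comp h.injective
  have harc : ∀ u v : V, convexHull ℝ ((fun v => circlePoint (θ v)) '' {w | w ∈ s(u, v)}) =
      segment ℝ (circlePoint (θ u)) (circlePoint (θ v)) := by
    intro u v
    rw [← convexHull_pair]
    congr 1
    ext z
    simp [eq_comm]
  refine ⟨⟨fun v => circlePoint (θ v), fun e => convexHull ℝ ((fun v => circlePoint (θ v)) ''
    {v | v ∈ e}), hpos, fun v => by simpa using norm_circlePoint _, ?_, ?_, ?_, ?_⟩⟩
  · intro u v huv
    refine ⟨fun t => AffineMap.lineMap (circlePoint (θ u)) (circlePoint (θ v)) (t : ℝ), ?_, ?_,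
      by simp, by simp, ?_⟩
    · exact (AffineMap.lineMap_continuous).comp continuous_subtype_val
    · exact (AffineMap.lineMap_injective ℝ (fun he => huv.ne (hpos he))).comp
        Subtype.val_injective
    · rw [harc, segment_eq_image_lineMap]
      ext z; simp
  · intro e _
    refine convexHull_min ?_ (convex_closedBall _ _)
    rintro _ ⟨v, -, rfl⟩
    simpa using (norm_circlePoint _).le
  · intro e
    induction e using Sym2.ind with | _ a c => ?_
    intro _ v hv
    rw [harc] at hv
    rcases chordForm_eq_zero (chordForm_eq_zero_of_mem_segment hv) with h1 | h1 <;>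
      simp [h.injective h1]
  · intro e
    induction e using Sym2.ind with | _ a c => ?_
    intro hac f
    induction f using Sym2.ind with | _ b d => ?_
    intro hbd hne z hz
    rw [harc, harc] at hz
    have h0 := chordForm_eq_zero_of_mem_segment hz.1
    have hz2 := hz.2
    rw [segment_eq_image_lineMap] at hz2
    obtain ⟨t, ⟨ht0, ht1⟩, rfl⟩ := hz2
    have hb : chordForm (θ a) (θ c) (circlePoint (θ b)) = 0 → b = a ∨ b = c :=
      fun h1 => (chordForm_eq_zero h1).imp (fun h2 => h.injective h2) (fun h2 => h.injective h2)
    have hd : chordForm (θ a) (θ c) (circlePoint (θ d)) = 0 → d = a ∨ d = c :=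
      fun h1 => (chordForm_eq_zero h1).imp (fun h2 => h.injective h2) (fun h2 => h.injective h2)
    rcases eq_or_lt_of_le ht0 with rfl | ht0
    · simp only [AffineMap.lineMap_apply_zero] at h0 ⊢
      exact ⟨b, ⟨by simpa using hb h0, by simp⟩, rfl⟩
    rcases eq_or_lt_of_le ht1 with rfl | ht1
    · simp only [AffineMap.lineMap_apply_one] at h0 ⊢
      exact ⟨d, ⟨by simpa using hd h0, by simp⟩, rfl⟩
    -- an inner point of the chord `bd` on the line `ac` forces both chords onto the same line
    exfalso
    rw [chordForm_lineMap] at h0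
    have hsep : 0 ≤ chordForm (θ a) (θ c) (circlePoint (θ b)) *
        chordForm (θ a) (θ c) (circlePoint (θ d)) := by
      rw [chordForm_circlePoint, chordForm_circlePoint, mul_mul_mul_comm]
      exact mul_nonneg (by positivity) (h.separate_nonneg hac hbd)
    generalize chordForm (θ a) (θ c) (circlePoint (θ b)) = p at *
    generalize chordForm (θ a) (θ c) (circlePoint (θ d)) = q at *
    have hp : p = 0 := by
      by_contra hp
      have : 0 < p ^ 2 := by positivity
      have h2 : (1 - t) * p ^ 2 + t * (p * q) = p * ((1 - t) * p + t * q) := by ring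
      rw [h0, mul_zero] at h2
      linarith [mul_pos (sub_pos.2 ht1) this, mul_nonneg ht0.le hsep]
    have hq : q = 0 := by
      subst hp
      simpa [ht0.ne'] using h0
    have hbdne : b ≠ d := G.ne_of_adj hbd
    rcases hb hp with rfl | rfl <;> rcases hd hq with rfl | rfl
    · exact hbdne rfl
    · exact hne rfl
    · exact hne Sym2.eq_swap
    · exact hbdne rfl

open Classical in
/-- At most `2 * R.card` edges have both ends in `R`. -/
theorem NonCrossing.card_adj_lt_le (h : NonCrossing G θ) (R : Finset V) :
    ((R ×ˢ R).filter fun p => G.Adj p.1 p.2 ∧ θ p.1 < θ p.2).card ≤ 2 * R.card := by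
  set E := (R ×ˢ R).filter fun p => G.Adj p.1 p.2 ∧ θ p.1 < θ p.2 with hE
  have hmem : ∀ {p}, p ∈ E → p.1 ∈ R ∧ p.2 ∈ R ∧ G.Adj p.1 p.2 ∧ θ p.1 < θ p.2 := by
    intro p hp; simpa [hE, and_assoc] using hp
  -- The longest edge to the right of a vertex is charged to this vertex, and every other edge to
  -- its right end; two edges charged to the same right end would make the longest one cross.
  rw [← Finset.card_filter_add_card_filter_not (fun p => ∀ p' ∈ E, p'.1 = p.1 → θ p'.2 ≤ θ p.2),
    two_mul]
  refine Nat.add_le_add (Finset.card_le_card_of_injOn Prod.fst ?_ ?_)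
    (Finset.card_le_card_of_injOn Prod.snd ?_ ?_)
  · intro p hp
    exact (hmem (Finset.mem_filter.1 hp).1).1
  · intro p hp q hq hpq
    obtain ⟨hp1, hp2⟩ := Finset.mem_filter.1 hp
    obtain ⟨hq1, hq2⟩ := Finset.mem_filter.1 hq
    exact Prod.ext hpq (h.injective (le_antisymm (hq2 p hp1 hpq) (hp2 q hq1 hpq.symm)))
  · intro p hp
    exact (hmem (Finset.mem_filter.1 hp).1).2.1
  · have key : ∀ p q : V × V, p ∈ E → q ∈ E →
        ¬ (∀ p' ∈ E, p'.1 = q.1 → θ p'.2 ≤ θ q.2) → p.2 = q.2 → ¬ θ p.1 < θ q.1 := by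
      intro p q hp hq hq' hpq hlt
      push Not at hq'
      obtain ⟨r, hr, hr1, hr2⟩ := hq'
      have hp3 := (hmem hp).2.2.1
      have hq3 := (hmem hq).2.2
      rw [hpq] at hp3
      exact h.not_adj p.1 q.1 q.2 r.2 hlt hq3.2 hr2 hp3 (hr1 ▸ (hmem hr).2.2.1)
    intro p hp q hq hpq
    obtain ⟨hp1, hp2⟩ := Finset.mem_filter.1 hp
    obtain ⟨hq1, hq2⟩ := Finset.mem_filter.1 hq
    exact Prod.ext (h.injective (le_antisymm (not_lt.1 (key q p hq1 hp1 hp2 hpq.symm))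
      (not_lt.1 (key p q hp1 hq1 hq2 hpq)))) hpq

open Classical in
/-- The degree sum of the subgraph induced by `R`. -/
theorem NonCrossing.sum_degree_le (h : NonCrossing G θ) (R : Finset V) :
    ∑ w ∈ R, (R.filter fun z => G.Adj w z).card ≤ 4 * R.card := by
  have h1 : ∑ w ∈ R, (R.filter fun z => G.Adj w z).card =
      ((R ×ˢ R).filter fun p => G.Adj p.1 p.2).card := by
    rw [Finset.card_filter, Finset.sum_product]
    exact Finset.sum_congr rfl fun w _ => Finset.card_filter _ _
  have h2 : ((R ×ˢ R).filter fun p => G.Adj p.1 p.2 ∧ ¬ θ p.1 < θ p.2).card ≤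
      ((R ×ˢ R).filter fun p => G.Adj p.1 p.2 ∧ θ p.1 < θ p.2).card := by
    refine Finset.card_le_card_of_injOn Prod.swap ?_ Prod.swap_injective.injOn
    intro p hp
    simp only [Finset.coe_filter, Finset.mem_product, Set.mem_ofPred_eq, Prod.fst_swap,
      Prod.snd_swap] at hp ⊢
    exact ⟨hp.1.symm, hp.2.1.symm, lt_of_le_of_ne (not_lt.1 hp.2.2)
      fun he => hp.2.1.ne (h.injective he.symm)⟩
  rw [h1, ← Finset.card_filter_add_card_filter_not (fun p : V × V => θ p.1 < θ p.2),
    Finset.filter_filter, Finset.filter_filter]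
  have := h.card_adj_lt_le R
  omega

open Classical in
/-- Outerplanar graphs contain no `K_{2,3}`. -/
theorem NonCrossing.card_common_le [Fintype V] (h : NonCrossing G θ) {u v : V} (huv : u ≠ v) :
    (Finset.univ.filter fun w => G.Adj u w ∧ G.Adj v w).card ≤ 2 := by
  wlog hlt : θ u < θ v generalizing u v
  · have := this huv.symm (lt_of_le_of_ne (not_lt.1 hlt) fun he => huv (h.injective he.symm))
    simpa only [and_comm] using this
  have inside : ∀ a b, G.Adj u a → G.Adj v a → G.Adj u b → G.Adj v b →
      (θ u < θ a ∧ θ a < θ v) → (θ u < θ b ∧ θ b < θ v) → ¬ θ a < θ b :=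
    fun a b _ va ub _ ha hb hab => h.not_adj u a b v ha.1 hab hb.2 ub va.symm
  have outside : ∀ a b, G.Adj u a → G.Adj v a → G.Adj u b → G.Adj v b →
      ¬ (θ u < θ a ∧ θ a < θ v) → ¬ (θ u < θ b ∧ θ b < θ v) → ¬ θ a < θ b := by
    intro a b ua va ub vb ha hb hab
    have hne : ∀ {x y}, G.Adj x y → θ x ≠ θ y := fun hxy he => hxy.ne (h.injective he)
    rcases lt_or_gt_of_ne (hne ua) with h1 | h1
    · have hva : θ v < θ a := lt_of_le_of_ne (not_lt.1 fun h2 => ha ⟨h1, h2⟩) (hne va)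
      exact h.not_adj u v a b hlt hva hab ua vb
    · rcases lt_or_gt_of_ne (hne ub) with h2 | h2
      · have hvb : θ v < θ b := lt_of_le_of_ne (not_lt.1 fun h3 => hb ⟨h2, h3⟩) (hne vb)
        exact h.not_adj a u v b h1 hlt hvb va.symm ub
      · exact h.not_adj a b u v hab h2 hlt ua.symm vb.symm
  have eq_of : ∀ a b, G.Adj u a → G.Adj v a → G.Adj u b → G.Adj v b →
      ((θ u < θ a ∧ θ a < θ v) ↔ (θ u < θ b ∧ θ b < θ v)) → a = b := by
    intro a b ua va ub vb hiff
    apply h.injective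
    by_cases ha : θ u < θ a ∧ θ a < θ v
    · exact le_antisymm (not_lt.1 (inside b a ub vb ua va (hiff.1 ha) ha))
        (not_lt.1 (inside a b ua va ub vb ha (hiff.1 ha)))
    · have hb := fun hb => ha (hiff.2 hb)
      exact le_antisymm (not_lt.1 (outside b a ub vb ua va hb ha))
        (not_lt.1 (outside a b ua va ub vb ha hb))
  by_contra! hcard
  obtain ⟨a, ha, b, hb, c, hc, hab, hac, hbc⟩ := Finset.two_lt_card.1 hcard
  simp only [Finset.mem_filter, Finset.mem_univ, true_and] at ha hb hc
  have e1 := mt (eq_of a b ha.1 ha.2 hb.1 hb.2) hab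
  have e2 := mt (eq_of a c ha.1 ha.2 hc.1 hc.2) hac
  have e3 := mt (eq_of b c hb.1 hb.2 hc.1 hc.2) hbc
  tauto

end OuterplanarSpectral

/-! ### The spectral radius and the Rayleigh quotient -/

namespace OuterplanarSpectral

variable {V : Type*} [Fintype V]

open Classical in
/-- The sum of the weights `x` over the neighbours of `v`, that is, the `v`-th entry of the product
of the adjacency matrix and `x`. -/
noncomputable def neighborSum (G : SimpleGraph V) (x : V → ℝ) (v : V) : ℝ :=
  ∑ w with G.Adj v w, x w

theorem neighborSum_eq_sum_ite (G : SimpleGraph V) (x : V → ℝ) (v : V)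
    [DecidableRel G.Adj] : neighborSum G x v = ∑ w, if G.Adj v w then x w else 0 := by
  rw [neighborSum, Finset.sum_filter]
  exact Finset.sum_congr rfl fun _ _ => by congr

theorem neighborSum_nonneg (G : SimpleGraph V) {x : V → ℝ} (hx : ∀ v, 0 ≤ x v) (v : V) :
    0 ≤ neighborSum G x v := Finset.sum_nonneg fun _ _ => hx _

/-- The adjacency matrix is symmetric. -/
theorem sum_mul_neighborSum_comm (G : SimpleGraph V) (x y : V → ℝ) :
    ∑ v, x v * neighborSum G y v = ∑ v, y v * neighborSum G x v := by
  classical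
  simp only [neighborSum_eq_sum_ite, Finset.mul_sum]
  rw [Finset.sum_comm]
  refine Finset.sum_congr rfl fun v _ => Finset.sum_congr rfl fun w _ => ?_
  rw [G.adj_comm]
  split_ifs <;> ring

theorem mulVec_adjMatrix (G : SimpleGraph V) [DecidableRel G.Adj] (x : V → ℝ) (v : V) :
    ((G.adjMatrix ℝ).mulVec x) v = neighborSum G x v := by
  rw [neighborSum_eq_sum_ite, SimpleGraph.adjMatrix_mulVec_apply, ← Finset.sum_filter]
  refine Finset.sum_congr ?_ fun _ _ => rfl
  ext w; simp

/-- The Rayleigh quotient of the adjacency matrix is bounded by its value at some nonnegative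
vector. -/
theorem exists_rayleigh_max [Nonempty V] (G : SimpleGraph V) :
    ∃ (r : ℝ) (x : V → ℝ), 0 ≤ r ∧ (∀ v, 0 ≤ x v) ∧ ∑ v, x v ^ 2 = 1 ∧
      ∑ v, x v * neighborSum G x v = r ∧
      ∀ y : V → ℝ, ∑ v, y v * neighborSum G y v ≤ r * ∑ v, y v ^ 2 := by
  classical
  have hcont : Continuous fun y : V → ℝ => ∑ v, y v * neighborSum G y v := by
    unfold neighborSum; fun_prop
  have hcomp : IsCompact {y : V → ℝ | ∑ v, y v ^ 2 = 1} := by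
    refine Metric.isCompact_of_isClosed_isBounded
      (isClosed_eq (by fun_prop) continuous_const) ?_
    refine (Metric.isBounded_closedBall (x := (0 : V → ℝ)) (r := 1)).subset fun y hy => ?_
    rw [mem_closedBall_zero_iff, pi_norm_le_iff_of_nonneg zero_le_one]
    intro v
    have h1 : y v ^ 2 ≤ ∑ v, y v ^ 2 :=
      Finset.single_le_sum (f := fun v => y v ^ 2) (fun _ _ => sq_nonneg _) (Finset.mem_univ v)
    rw [show ∑ v, y v ^ 2 = 1 from hy] at h1
    rw [Real.norm_eq_abs]
    exact abs_le_one_iff_mul_self_le_one.2 (by nlinarith)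
  have hne : {y : V → ℝ | ∑ v, y v ^ 2 = 1}.Nonempty := by
    obtain ⟨v⟩ := ‹Nonempty V›
    exact ⟨Pi.single v 1, by simp [Pi.single_apply]⟩
  obtain ⟨z, hz, hmax⟩ := hcomp.exists_isMaxOn hne hcont.continuousOn
  replace hz : ∑ v, z v ^ 2 = 1 := hz
  have habs : ∀ y : V → ℝ, ∑ v, y v * neighborSum G y v ≤
      ∑ v, |y v| * neighborSum G (fun v => |y v|) v := fun y => by
    refine Finset.sum_le_sum fun v _ => ?_
    refine (le_abs_self _).trans ?_
    rw [abs_mul]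
    exact mul_le_mul_of_nonneg_left (Finset.abs_sum_le_sum_abs _ _) (abs_nonneg _)
  have hz' : ∑ v, |z v| ^ 2 = 1 := by simpa only [sq_abs] using hz
  have hmax' : ∀ y : V → ℝ, ∑ v, y v ^ 2 = 1 → ∑ v, y v * neighborSum G y v ≤
      ∑ v, |z v| * neighborSum G (fun v => |z v|) v := fun y hy => (hmax hy).trans (habs z)
  refine ⟨_, fun v => |z v|, Finset.sum_nonneg fun v _ => mul_nonneg (abs_nonneg _)
    (neighborSum_nonneg G (fun _ => abs_nonneg _) v), fun _ => abs_nonneg _, hz', rfl, ?_⟩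
  intro y
  have hs : 0 ≤ ∑ v, y v ^ 2 := Finset.sum_nonneg fun _ _ => sq_nonneg _
  rcases eq_or_lt_of_le hs with h0 | h0
  · have hy : y = 0 := by
      funext v
      have := (Finset.sum_eq_zero_iff_of_nonneg fun v _ => sq_nonneg (y v)).1 h0.symm v
        (Finset.mem_univ v)
      simpa using this
    simp [hy]
  · set s := ∑ v, y v ^ 2 with hsdef
    have hsq : √s ^ 2 = s := Real.sq_sqrt hs
    have hsp : 0 < √s := Real.sqrt_pos.2 h0
    have := hmax' (fun v => (√s)⁻¹ * y v) (by
      simp only [mul_pow]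
      rw [← Finset.mul_sum, ← hsdef, inv_pow, hsq, inv_mul_cancel₀ h0.ne'])
    have h2 : ∀ v, neighborSum G (fun v => (√s)⁻¹ * y v) v = (√s)⁻¹ * neighborSum G y v :=
      fun v => (Finset.mul_sum _ _ _).symm
    simp only [h2] at this
    have h3 : ∑ v, (√s)⁻¹ * y v * ((√s)⁻¹ * neighborSum G y v) =
        s⁻¹ * ∑ v, y v * neighborSum G y v := by
      rw [Finset.mul_sum]
      refine Finset.sum_congr rfl fun v _ => ?_
      rw [mul_mul_mul_comm, ← mul_inv, ← sq, hsq]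
    rw [h3, inv_mul_le_iff₀ h0, mul_comm] at this
    exact this

/-- Where the Rayleigh quotient attains its maximum, it has an eigenvector. -/
theorem neighborSum_eq_of_rayleigh_eq (G : SimpleGraph V) {r : ℝ}
    (hr : ∀ y : V → ℝ, ∑ v, y v * neighborSum G y v ≤ r * ∑ v, y v ^ 2) {x : V → ℝ}
    (hx : r * ∑ v, x v ^ 2 ≤ ∑ v, x v * neighborSum G x v) (v : V) :
    neighborSum G x v = r * x v := by
  classical
  have hmul : ∀ y : V → ℝ, (r • (1 : Matrix V V ℝ) - G.adjMatrix ℝ).mulVec y =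
      fun v => r * y v - neighborSum G y v := by
    intro y; funext v
    rw [Matrix.sub_mulVec, Matrix.smul_mulVec, Matrix.one_mulVec, Pi.sub_apply, mulVec_adjMatrix]
    rfl
  have hdot : ∀ y : V → ℝ, y ⬝ᵥ (fun v => r * y v - neighborSum G y v) =
      r * ∑ v, y v ^ 2 - ∑ v, y v * neighborSum G y v := by
    intro y
    rw [Finset.mul_sum, ← Finset.sum_sub_distrib]
    exact Finset.sum_congr rfl fun v _ => by ring
  have hpsd : (r • (1 : Matrix V V ℝ) - G.adjMatrix ℝ).PosSemidef := by
    refine Matrix.PosSemidef.of_dotProduct_mulVec_nonneg ?_ fun y => ?_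
    · have h1 : (G.adjMatrix ℝ).IsHermitian := by
        rw [Matrix.IsHermitian, Matrix.conjTranspose_eq_transpose_of_trivial,
          SimpleGraph.transpose_adjMatrix]
      refine Matrix.IsHermitian.sub ?_ h1
      rw [Matrix.IsHermitian, Matrix.conjTranspose_smul, Matrix.conjTranspose_one]
      rfl
    · rw [hmul, star_trivial, hdot]
      linarith [hr y]
  have h0 := (hpsd.dotProduct_mulVec_zero_iff x).1 (by
    rw [hmul, star_trivial, hdot]
    linarith [hr x])
  rw [hmul] at h0
  have := congrFun h0 v
  simp only [Pi.zero_apply] at this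
  linarith

theorem mem_spectrum_adjMatrix_iff (G : SimpleGraph V) [DecidableEq V] [DecidableRel G.Adj]
    (k : ℝ) :
    k ∈ spectrum ℝ (G.adjMatrix ℝ) ↔ ∃ y : V → ℝ, y ≠ 0 ∧ ∀ v, neighborSum G y v = k * y v := by
  rw [spectrum.mem_iff, Matrix.isUnit_iff_isUnit_det, isUnit_iff_ne_zero, not_not,
    ← Matrix.exists_mulVec_eq_zero_iff]
  refine exists_congr fun y => and_congr_right fun _ => ?_
  rw [funext_iff]
  refine forall_congr' fun v => ?_
  rw [Matrix.sub_mulVec, Algebra.algebraMap_eq_smul_one, Matrix.smul_mulVec, Matrix.one_mulVec,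
    Pi.sub_apply, mulVec_adjMatrix, Pi.smul_apply, smul_eq_mul, Pi.zero_apply, sub_eq_zero,
    eq_comm]

/-- The spectral radius of the adjacency matrix is an eigenvalue with a nonnegative eigenvector,
and it is the maximum of the Rayleigh quotient. -/
theorem exists_perron_vector [Nonempty V] (G : SimpleGraph V) :
    ∃ (r : ℝ) (x : V → ℝ), 0 ≤ r ∧ rho G = ENNReal.ofReal r ∧ (∀ v, 0 ≤ x v) ∧ x ≠ 0 ∧
      (∀ v, neighborSum G x v = r * x v) ∧
      ∀ y : V → ℝ, ∑ v, y v * neighborSum G y v ≤ r * ∑ v, y v ^ 2 := by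
  obtain ⟨r, x, hr0, hx0, hx1, hxr, hmax⟩ := exists_rayleigh_max G
  have heig := neighborSum_eq_of_rayleigh_eq G hmax (x := x) (by rw [hx1, hxr, mul_one])
  have hxne : x ≠ 0 := by rintro rfl; simp at hx1
  refine ⟨r, x, hr0, ?_, hx0, hxne, heig, hmax⟩
  classical
  rw [rho, spectralRadius]
  apply le_antisymm
  · refine iSup₂_le fun k hk => ?_
    obtain ⟨y, hy, hyk⟩ := (mem_spectrum_adjMatrix_iff G k).1 (by convert! hk)
    have hpos : 0 < ∑ v, |y v| ^ 2 := by
      obtain ⟨v, hv⟩ := Function.ne_iff.1 hy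
      exact Finset.sum_pos' (fun _ _ => by positivity)
        ⟨v, Finset.mem_univ v, by have : y v ≠ 0 := hv; positivity⟩
    have h1 : |k| * ∑ v, |y v| ^ 2 ≤ ∑ v, |y v| * neighborSum G (fun v => |y v|) v := by
      rw [Finset.mul_sum]
      refine Finset.sum_le_sum fun v _ => ?_
      rw [sq, mul_left_comm, ← abs_mul, ← hyk]
      exact mul_le_mul_of_nonneg_left (Finset.abs_sum_le_sum_abs _ _) (abs_nonneg _)
    have h2 := le_of_mul_le_mul_right (h1.trans (hmax _)) hpos
    rw [ENNReal.ofReal, ENNReal.coe_le_coe]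
    exact NNReal.le_toNNReal_of_coe_le h2
  · have h1 : r ∈ spectrum ℝ (G.adjMatrix ℝ) := (mem_spectrum_adjMatrix_iff G r).2 ⟨x, hxne, heig⟩
    refine le_trans ?_ (le_iSup₂ (f := fun k (_ : k ∈ spectrum ℝ (G.adjMatrix ℝ)) =>
      (‖k‖₊ : ENNReal)) r (by convert! h1))
    rw [ENNReal.ofReal, ENNReal.coe_le_coe]
    exact Real.toNNReal_le_iff_le_coe.2 (le_abs_self r)

theorem rho_congr {W : Type*} [Fintype W] {G : SimpleGraph V} {H : SimpleGraph W} (e : G ≃g H) :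
    rho G = rho H := by
  classical
  have hsum : ∀ (y : W → ℝ) v, neighborSum G (fun v => y (e v)) v = neighborSum H y (e v) := by
    intro y v
    rw [neighborSum_eq_sum_ite, neighborSum_eq_sum_ite, ← Equiv.sum_comp e.toEquiv]
    refine Finset.sum_congr rfl fun w _ => ?_
    rw [← e.map_adj_iff]
    rfl
  have hspec : spectrum ℝ (G.adjMatrix ℝ) = spectrum ℝ (H.adjMatrix ℝ) := by
    ext k
    rw [mem_spectrum_adjMatrix_iff, mem_spectrum_adjMatrix_iff]
    constructor
    · rintro ⟨y, hy, h⟩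
      refine ⟨fun w => y (e.symm w), fun h0 => hy (funext fun v => ?_), fun w => ?_⟩
      · simpa using congrFun h0 (e v)
      · rw [← e.apply_symm_apply w, ← hsum]; simpa using h (e.symm w)
    · rintro ⟨y, hy, h⟩
      refine ⟨fun v => y (e v), fun h0 => hy (funext fun w => ?_), fun v => ?_⟩
      · simpa using congrFun h0 (e.symm w)
      · rw [hsum]; exact h _
  rw [rho, rho, spectralRadius, spectralRadius]
  convert! congrArg (fun s : Set ℝ => ⨆ k ∈ s, (‖k‖₊ : ENNReal)) hspec

end OuterplanarSpectral

/-! ### A dominating vertex -/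

namespace OuterplanarSpectral

variable {V : Type*} [Fintype V]

open Classical in
theorem neighborSum_one (G : SimpleGraph V) (v : V) :
    neighborSum G (fun _ => 1) v = ((Finset.univ.filter fun w => G.Adj v w).card : ℝ) := by
  simp [neighborSum]

open Classical in
/-- Counting walks of length two from `v` by their ends: an end other than `v` is reached at most
twice, for lack of a `K_{2,3}`. -/
theorem NonCrossing.neighborSum_neighborSum_le {G : SimpleGraph V} {θ : V → ℝ}
    (h : NonCrossing G θ) {x : V → ℝ} (hx : ∀ v, 0 ≤ x v) (v : V) :
    neighborSum G (neighborSum G x) v ≤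
      ((Finset.univ.filter fun w => G.Adj v w).card : ℝ) * x v + 2 * ∑ z, x z := by
  have h1 : neighborSum G (neighborSum G x) v =
      ∑ z, ((Finset.univ.filter fun w => G.Adj v w ∧ G.Adj z w).card : ℝ) * x z := by
    simp only [neighborSum_eq_sum_ite, Finset.card_filter, Nat.cast_sum, Finset.sum_mul]
    rw [Finset.sum_comm]
    refine Finset.sum_congr rfl fun w _ => ?_
    by_cases hvw : G.Adj v w
    · simp only [hvw, if_true, true_and]
      refine Finset.sum_congr rfl fun z _ => ?_
      rw [G.adj_comm]
      split_ifs <;> simp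
    · simp [hvw]
  have h2 : ((Finset.univ.filter fun w => G.Adj v w).card : ℝ) * x v + 2 * ∑ z, x z =
      ∑ z, ((if z = v then ((Finset.univ.filter fun w => G.Adj v w).card : ℝ) * x v else 0) +
        2 * x z) := by
    rw [Finset.sum_add_distrib, ← Finset.mul_sum]
    simp
  rw [h1, h2]
  refine Finset.sum_le_sum fun z _ => ?_
  by_cases hz : z = v
  · subst hz
    simp only [and_self, if_true]
    linarith [hx z]
  · rw [if_neg hz, zero_add]
    refine mul_le_mul_of_nonneg_right ?_ (hx z)
    exact_mod_cast h.card_common_le (Ne.symm hz)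

open Classical in
/-- In an outerplanar graph of large spectral radius, a vertex of maximal Perron weight `1`
outweighs the whole neighbourhood of each vertex that is not adjacent to it. -/
theorem NonCrossing.neighborSum_lt_one {G : SimpleGraph V} {θ : V → ℝ} (h : NonCrossing G θ)
    (hn : (1.27e7 : ℝ) ≤ Fintype.card V) {r : ℝ} (hr0 : 0 ≤ r)
    (hr : (Fintype.card V : ℝ) - 1 ≤ r ^ 2) {x : V → ℝ} (hx : ∀ v, 0 ≤ x v)
    (heig : ∀ v, neighborSum G x v = r * x v) {u : V} (hu : x u = 1) (hmax : ∀ v, x v ≤ 1)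
    {v : V} (hvu : v ≠ u) (huv : ¬ G.Adj u v) : neighborSum G x v < 1 := by
  set N : ℝ := (Fintype.card V : ℝ) with hN
  set d : V → ℝ := fun v => ((Finset.univ.filter fun w => G.Adj v w).card : ℝ) with hd
  set S : ℝ := ∑ z, x z with hS
  have hr1 : (3563 : ℝ) ≤ r := by
    by_contra! hlt
    norm_num at hn
    nlinarith
  have hrpos : 0 < r := by linarith
  have hS5 : S ≤ 5 * r := by
    have h1 : r * S ≤ 4 * N := by
      calc r * S = ∑ w, 1 * neighborSum G x w := by
            rw [hS, Finset.mul_sum]; exact Finset.sum_congr rfl fun w _ => by rw [heig, one_mul]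
        _ = ∑ w, x w * d w := by
            rw [sum_mul_neighborSum_comm G (fun _ => 1) x]
            simp only [neighborSum_one, hd]
        _ ≤ ∑ w, d w := Finset.sum_le_sum fun w _ =>
            mul_le_of_le_one_left (Nat.cast_nonneg _) (hmax w)
        _ ≤ 4 * N := by
            have := h.sum_degree_le Finset.univ
            rw [Finset.card_univ] at this
            simp only [hd, hN]
            exact_mod_cast this
    have h2 : r * S ≤ r * (5 * r) := by nlinarith
    exact le_of_mul_le_mul_left h2 hrpos
  have hwalk : ∀ w, r ^ 2 * x w ≤ d w * x w + 2 * S := by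
    intro w
    have h1 := h.neighborSum_neighborSum_le hx w
    have h2 : neighborSum G (neighborSum G x) w = r ^ 2 * x w := by
      have : neighborSum G (fun v => r * x v) w = r * neighborSum G x w :=
        (Finset.mul_sum _ _ _).symm
      rw [show neighborSum G x = fun v => r * x v from funext heig, this, heig]; ring
    rwa [h2] at h1
  have hdu : r ^ 2 - 2 * S ≤ d u := by
    have := hwalk u
    rw [hu] at this; linarith
  set R : Finset V := Finset.univ.filter fun w => w ≠ u ∧ ¬ G.Adj u w with hR
  have hRcard : (R.card : ℝ) + d u + 1 = N := by
    have h1 : Finset.univ.filter (fun w => ¬ G.Adj u w) = insert u R := by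
      ext w
      by_cases hw : w = u <;> simp [hR, hw]
    have h2 := Finset.card_filter_add_card_filter_not (s := Finset.univ) (fun w => G.Adj u w)
    rw [h1, Finset.card_insert_of_notMem (by simp [hR]), Finset.card_univ] at h2
    simp only [hN, hd, ← h2]
    push_cast; ring
  have hR10 : (R.card : ℝ) ≤ 10 * r := by linarith
  -- the neighbourhood of a vertex `w ≠ u`, apart from at most two vertices, avoids that of `u`
  have hcommon : ∀ w, w ≠ u →
      ((Finset.univ.filter fun z => G.Adj u z ∧ G.Adj w z).card : ℝ) ≤ 2 := fun w hw => by
    exact_mod_cast h.card_common_le hw.symm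
  have hx21 : ∀ w, w ≠ u → x w ≤ 21 / r := by
    intro w hw
    have h1 : d w ≤ R.card + 3 := by
      have hsub : Finset.univ.filter (fun z => G.Adj w z) ⊆
          insert u (R ∪ Finset.univ.filter fun z => G.Adj u z ∧ G.Adj w z) := by
        intro z hz
        simp only [hR, Finset.mem_insert, Finset.mem_union, Finset.mem_filter, Finset.mem_univ,
          true_and] at hz ⊢
        tauto
      have h2 := (Finset.card_le_card hsub).trans ((Finset.card_insert_le _ _).trans
        (Nat.add_le_add_right (Finset.card_union_le _ _) 1))
      have h3 : d w ≤ (R.card : ℝ) +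
          ((Finset.univ.filter fun z => G.Adj u z ∧ G.Adj w z).card : ℝ) + 1 := by
        simp only [hd]
        exact_mod_cast h2
      linarith [hcommon w hw]
    have h2 : d w * x w ≤ d w := mul_le_of_le_one_right (Nat.cast_nonneg _) (hmax w)
    have h3 : r * (r * x w) ≤ r * 21 := by
      have := hwalk w
      nlinarith
    rw [le_div_iff₀ hrpos, mul_comm]
    exact le_of_mul_le_mul_left h3 hrpos
  have hdR : ∀ w ∈ R, Finset.univ.filter (fun z => G.Adj w z) =
      (Finset.univ.filter fun z => G.Adj u z ∧ G.Adj w z) ∪ R.filter fun z => G.Adj w z := by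
    intro w hw
    have hw' : ¬ G.Adj u w := (Finset.mem_filter.1 hw).2.2
    ext z
    have : G.Adj w z → z ≠ u := by rintro hz rfl; exact hw' hz.symm
    simp only [hR, Finset.mem_union, Finset.mem_filter, Finset.mem_univ, true_and]
    tauto
  have hRne : ∀ w ∈ R, w ≠ u := fun w hw => (Finset.mem_filter.1 hw).2.1
  have hsumR : ∑ w ∈ R, x w ≤ 1260 / r := by
    have h1 : ∀ w ∈ R, r * x w ≤ 21 / r * (2 + ((R.filter fun z => G.Adj w z).card : ℝ)) := by
      intro w hw
      rw [← heig]
      have h2 : neighborSum G x w ≤ d w * (21 / r) := by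
        rw [← nsmul_eq_mul]
        refine Finset.sum_le_card_nsmul _ _ _ fun z hz => hx21 z ?_
        rintro rfl
        exact (Finset.mem_filter.1 hw).2.2 (Finset.mem_filter.1 hz).2.symm
      have h3 : d w ≤ 2 + ((R.filter fun z => G.Adj w z).card : ℝ) := by
        have h4 := Finset.card_union_le (Finset.univ.filter fun z => G.Adj u z ∧ G.Adj w z)
          (R.filter fun z => G.Adj w z)
        rw [← hdR w hw] at h4
        have h5 : d w ≤ ((Finset.univ.filter fun z => G.Adj u z ∧ G.Adj w z).card : ℝ) +
          ((R.filter fun z => G.Adj w z).card : ℝ) := by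
          simp only [hd]
          exact_mod_cast h4
        linarith [hcommon w (hRne w hw)]
      rw [mul_comm (21 / r)]
      exact h2.trans (mul_le_mul_of_nonneg_right h3 (by positivity))
    have h2 : r * ∑ w ∈ R, x w ≤ 21 / r * (6 * R.card) := by
      rw [Finset.mul_sum]
      refine (Finset.sum_le_sum h1).trans ?_
      rw [← Finset.mul_sum, Finset.sum_add_distrib, Finset.sum_const, nsmul_eq_mul]
      refine mul_le_mul_of_nonneg_left ?_ (by positivity)
      have : (∑ w ∈ R, ((R.filter fun z => G.Adj w z).card : ℝ)) ≤ 4 * R.card := by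
        exact_mod_cast h.sum_degree_le R
      linarith
    have h3 : 21 / r * (6 * R.card) ≤ 1260 := by
      rw [div_mul_eq_mul_div, div_le_iff₀ hrpos]; linarith
    rw [le_div_iff₀ hrpos]; linarith
  have hv : v ∈ R := by simp [hR, hvu, huv]
  have h1 : neighborSum G x v ≤ 42 / r + 1260 / r := by
    rw [neighborSum, hdR v hv]
    have h0 := Finset.sum_union_inter (f := x)
      (s₁ := Finset.univ.filter fun z => G.Adj u z ∧ G.Adj v z) (s₂ := R.filter fun z => G.Adj v z)
    refine (le_add_of_nonneg_right (Finset.sum_nonneg fun _ _ => hx _)).trans (h0.le.trans ?_)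
    refine add_le_add ?_ ((Finset.sum_le_sum_of_subset_of_nonneg (Finset.filter_subset _ _)
      fun _ _ _ => hx _).trans hsumR)
    have h2 := Finset.sum_le_card_nsmul (Finset.univ.filter fun z => G.Adj u z ∧ G.Adj v z) x
      (21 / r) fun z hz => hx21 z (Finset.mem_filter.1 hz).2.1.ne'
    rw [nsmul_eq_mul] at h2
    refine h2.trans ((mul_le_mul_of_nonneg_right (hcommon v hvu) (by positivity)).trans ?_)
    rw [← mul_div_assoc]; norm_num
  refine h1.trans_lt ?_
  rw [← add_div, div_lt_one hrpos]
  linarith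

/-- The graph in which `v` has been detached from all its neighbours and attached to `u` alone. -/
def reattach {V : Type*} (G : SimpleGraph V) (v u : V) : SimpleGraph V where
  Adj a b := (a ≠ v ∧ b ≠ v ∧ G.Adj a b) ∨ (a ≠ b ∧ ((a = v ∧ b = u) ∨ (a = u ∧ b = v)))
  symm := ⟨fun a b h => by
    rcases h with ⟨h1, h2, h3⟩ | ⟨h1, h2⟩
    · exact Or.inl ⟨h2, h1, h3.symm⟩
    · exact Or.inr ⟨h1.symm, by tauto⟩⟩
  loopless := ⟨fun a h => by
    rcases h with ⟨_, _, h⟩ | ⟨h, _⟩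
    · exact G.loopless.irrefl a h
    · exact h rfl⟩

theorem reattach_adj {V : Type*} {G : SimpleGraph V} {v u a b : V} : (reattach G v u).Adj a b ↔
    (a ≠ v ∧ b ≠ v ∧ G.Adj a b) ∨ (a ≠ b ∧ ((a = v ∧ b = u) ∨ (a = u ∧ b = v))) := Iff.rfl

/-- A vertex can be moved next to the last vertex of a non-crossing order. -/
theorem NonCrossing.reattach {V : Type*} {G : SimpleGraph V} {θ : V → ℝ} (h : NonCrossing G θ)
    {u v : V} (hvu : v ≠ u) (hu : ∀ w, w ≠ u → θ w < θ u) :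
    ∃ θ', NonCrossing (OuterplanarSpectral.reattach G v u) θ' := by
  classical
  refine ⟨Function.update θ v (θ u + 1), ?_, ?_⟩
  · have hle : ∀ w, θ w < θ u + 1 := fun w => by
      by_cases hw : w = u
      · subst hw; linarith
      · linarith [hu w hw]
    intro a b hab
    by_cases ha : a = v <;> by_cases hb : b = v
    · rw [ha, hb]
    · subst ha
      rw [Function.update_self, Function.update_of_ne hb] at hab
      exact absurd hab (hle b).ne'
    · subst hb
      rw [Function.update_self, Function.update_of_ne ha] at hab
      exact absurd hab (hle a).ne
    · rw [Function.update_of_ne ha, Function.update_of_ne hb] at hab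
      exact h.injective hab
  · intro a b c d hab hbc hcd hac hbd
    have hlt : ∀ {w}, w ≠ v → Function.update θ v (θ u + 1) w ≤ θ u := fun {w} hw => by
      rw [Function.update_of_ne hw]
      by_cases hw' : w = u
      · rw [hw']
      · exact (hu w hw').le
    have hself : Function.update θ v (θ u + 1) v = θ u + 1 := Function.update_self ..
    have hcv : c ≠ v := by
      rintro rfl
      by_cases hd : d = c
      · subst hd; exact lt_irrefl _ hcd
      · linarith [hlt hd]
    have hbv : b ≠ v := by
      rintro rfl
      linarith [hlt hcv]
    have hav : a ≠ v := by
      rintro rfl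
      linarith [hlt hbv]
    have hac' : G.Adj a c := by
      rcases hac with ⟨_, _, h⟩ | ⟨_, ⟨h, _⟩ | ⟨_, h⟩⟩
      exacts [h, absurd h hav, absurd h hcv]
    rcases hbd with ⟨_, hdv, h3⟩ | ⟨_, ⟨h3, _⟩ | ⟨h3, rfl⟩⟩
    · rw [Function.update_of_ne hav, Function.update_of_ne hbv] at hab
      rw [Function.update_of_ne hcv, Function.update_of_ne hbv] at hbc
      rw [Function.update_of_ne hcv, Function.update_of_ne hdv] at hcd
      exact h.not_adj a b c d hab hbc hcd hac' h3
    · exact hbv h3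
    · subst h3
      rw [Function.update_of_ne hbv] at hbc
      linarith [hlt hcv]

/-- A graph without vertices of degree at most one cannot use the pendant edge `uv`. -/
theorem free_reattach {V W : Type*} {F : SimpleGraph W} {G : SimpleGraph V} (hF : F.Free G)
    (hdeg : ∀ p, ∃ q q', q ≠ q' ∧ F.Adj p q ∧ F.Adj p q') (v u : V) :
    F.Free (reattach G v u) := by
  rintro ⟨f⟩
  have hv : ∀ p, f p ≠ v := by
    intro p hp
    obtain ⟨q, q', hqq', hq, hq'⟩ := hdeg p
    have key : ∀ q, F.Adj p q → f q = u := by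
      intro q hq
      rcases f.toHom.map_adj hq with ⟨h, _, _⟩ | ⟨_, ⟨_, h⟩ | ⟨h, h'⟩⟩
      · exact absurd hp h
      · exact h
      · exact h'.trans (hp.symm.trans h)
    exact hqq' (f.injective ((key q hq).trans (key q' hq').symm))
  refine hF ⟨⟨⟨f, fun {a b} hab => ?_⟩, f.injective⟩⟩
  rcases f.toHom.map_adj hab with ⟨_, _, h⟩ | ⟨_, ⟨h, _⟩ | ⟨_, h⟩⟩
  exacts [h, absurd h (hv a), absurd h (hv b)]

theorem neighborSum_reattach (G : SimpleGraph V) [DecidableEq V] [DecidableRel G.Adj] (x : V → ℝ)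
    {u v : V} (hvu : v ≠ u) (huv : ¬ G.Adj u v) (w : V) :
    neighborSum (reattach G v u) x w = neighborSum G x w +
      ((if w = v then x u - neighborSum G x v else 0) + (if w = u then x v else 0) -
        (if G.Adj v w then x v else 0)) := by
  classical
  simp only [neighborSum_eq_sum_ite]
  by_cases hw : w = v
  · subst hw
    simp only [reattach_adj, ne_eq, not_true_eq_false, false_and, false_or, true_and, hvu, or_false]
    rw [Finset.sum_eq_single u] <;> simp +contextual [hvu]
  · have h1 : (if w = u then x v else 0) = ∑ z, if w = u ∧ z = v then x z else 0 := by
      by_cases h : w = u <;> simp [h]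
    have h2 : (if G.Adj v w then x v else 0) = ∑ z, if G.Adj w z ∧ z = v then x z else 0 := by
      by_cases h : G.Adj v w
      · rw [if_pos h, Finset.sum_eq_single v] <;> simp +contextual [h.symm]
      · rw [if_neg h]
        refine (Finset.sum_eq_zero fun z _ => if_neg ?_).symm
        rintro ⟨h3, rfl⟩
        exact h h3.symm
    rw [if_neg hw, zero_add, h1, h2, ← Finset.sum_sub_distrib, ← Finset.sum_add_distrib]
    refine Finset.sum_congr rfl fun z _ => ?_
    by_cases hz : z = v
    · subst hz
      by_cases hwu : w = u
      · subst hwu; simp [reattach_adj, hw, huv]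
      · by_cases hwz : G.Adj w z <;> simp [reattach_adj, hw, hwu, hwz]
    · simp [reattach_adj, hw, hz]

/-- If the Perron weight of `u` exceeds the total weight of the neighbours of `v`, then moving
`v` to `u` increases the spectral radius. -/
theorem rho_lt_rho_reattach (G : SimpleGraph V) {r : ℝ} (hr0 : 0 ≤ r)
    (hrho : rho G = ENNReal.ofReal r) {x : V → ℝ} (hx : ∀ v, 0 ≤ x v)
    (heig : ∀ v, neighborSum G x v = r * x v) {u v : V} (hvu : v ≠ u) (huv : ¬ G.Adj u v)
    (hlt : neighborSum G x v < x u) : rho G < rho (reattach G v u) := by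
  classical
  have : Nonempty V := ⟨u⟩
  obtain ⟨r', x', hr0', hrho', -, -, -, hmax⟩ := exists_perron_vector (reattach G v u)
  rw [hrho, hrho', ENNReal.ofReal_lt_ofReal_iff_of_nonneg hr0]
  by_contra! hle
  have hsum : ∑ w, x w * neighborSum (reattach G v u) x w =
      r * ∑ w, x w ^ 2 + 2 * (x v * (x u - neighborSum G x v)) := by
    simp only [neighborSum_reattach G x hvu huv, mul_add, mul_sub, Finset.sum_add_distrib,
      Finset.sum_sub_distrib, mul_ite, mul_zero, Finset.sum_ite_eq', Finset.mem_univ, if_true]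
    have h1 : ∑ w, x w * neighborSum G x w = r * ∑ w, x w ^ 2 := by
      rw [Finset.mul_sum]; exact Finset.sum_congr rfl fun w _ => by rw [heig]; ring
    have h2 : (∑ w, if G.Adj v w then x w * x v else 0) = neighborSum G x v * x v := by
      rw [neighborSum_eq_sum_ite, Finset.sum_mul]
      exact Finset.sum_congr rfl fun w _ => by split_ifs <;> simp
    rw [h1, h2]; ring
  have hpos : 0 ≤ x v * (x u - neighborSum G x v) := mul_nonneg (hx v) (by linarith)
  have hs : 0 ≤ ∑ w, x w ^ 2 := Finset.sum_nonneg fun _ _ => sq_nonneg _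
  have hmax' : ∀ y : V → ℝ, ∑ w, y w * neighborSum (reattach G v u) y w ≤ r * ∑ w, y w ^ 2 :=
    fun y => (hmax y).trans
      (mul_le_mul_of_nonneg_right hle (Finset.sum_nonneg fun _ _ => sq_nonneg _))
  -- `x` would be an eigenvector of the new graph too, but its value at `v` is now too small
  have h1 := neighborSum_eq_of_rayleigh_eq _ hmax' (x := x) (by rw [hsum]; linarith) v
  rw [neighborSum_reattach G x hvu huv, if_pos rfl, if_neg hvu, if_neg (G.loopless.irrefl v),
    ← heig v] at h1
  linarith

/-- An outerplanar graph of large spectral radius without a dominating vertex can be modified so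
that the spectral radius increases, by moving a vertex `v` to a vertex `u`. -/
theorem IsOuterplanar.exists_dominating_or_reattach {G : SimpleGraph V} (hG : IsOuterplanar G)
    (hn : (1.27e7 : ℝ) ≤ Fintype.card V)
    (hr : ENNReal.ofReal (√((Fintype.card V : ℝ) - 1)) ≤ rho G) :
    (∃ u, ∀ v, v ≠ u → G.Adj u v) ∨
      ∃ u v, IsOuterplanar (reattach G v u) ∧ rho G < rho (reattach G v u) := by
  have hcard : 0 < Fintype.card V := by
    by_contra! h0
    rw [Nat.le_zero.1 h0] at hn; norm_num at hn
  have : Nonempty V := Fintype.card_pos_iff.1 hcard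
  obtain ⟨r, x, hr0, hrho, hx, hxne, heig, -⟩ := exists_perron_vector G
  rw [hrho, ENNReal.ofReal_le_ofReal_iff hr0] at hr
  have hr2 : (Fintype.card V : ℝ) - 1 ≤ r ^ 2 := (Real.sqrt_le_left hr0).1 hr
  obtain ⟨u, hu⟩ := Finite.exists_max x
  have hupos : 0 < x u := by
    obtain ⟨v, hv⟩ := Function.ne_iff.1 hxne
    exact (lt_of_le_of_ne (hx v) (Ne.symm hv)).trans_le (hu v)
  by_cases hdom : ∀ v, v ≠ u → G.Adj u v
  · exact Or.inl ⟨u, hdom⟩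
  push Not at hdom
  obtain ⟨v, hvu, huv⟩ := hdom
  obtain ⟨θ, hθ, hθu⟩ := hG.exists_nonCrossing u
  obtain ⟨θ', hθ'⟩ := hθ.reattach hvu hθu
  have hscale : ∀ v, neighborSum G (fun v => (x u)⁻¹ * x v) v = (x u)⁻¹ * neighborSum G x v :=
    fun v => (Finset.mul_sum _ _ _).symm
  have hlt := hθ.neighborSum_lt_one hn hr0 hr2 (x := fun v => (x u)⁻¹ * x v)
    (fun v => mul_nonneg (inv_nonneg.2 hupos.le) (hx v))
    (fun v => by rw [hscale, heig]; ring) (inv_mul_cancel₀ hupos.ne')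
    (fun v => by rw [inv_mul_le_iff₀ hupos, mul_one]; exact hu v) hvu huv
  rw [hscale, inv_mul_lt_iff₀ hupos, mul_one] at hlt
  exact Or.inr ⟨u, v, hθ'.isOuterplanar, rho_lt_rho_reattach G hr0 hrho hx heig hvu huv hlt⟩

end OuterplanarSpectral

/-! ### Joins of a vertex and a linear forest -/

namespace OuterplanarSpectral

/-- The disjoint union of paths with `m i` vertices, where `i` ranges over the index type. -/
def linearForest {ι : Type*} (m : ι → ℕ) : SimpleGraph (Σ i, Fin (m i)) where
  Adj a b := a.1 = b.1 ∧ ((a.2 : ℕ) + 1 = b.2 ∨ (b.2 : ℕ) + 1 = a.2)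
  symm := ⟨fun _ _ h => ⟨h.1.symm, h.2.symm⟩⟩
  loopless := ⟨fun _ h => by rcases h.2 with h | h <;> omega⟩

theorem linearForest_adj {ι : Type*} {m : ι → ℕ} {a b : Σ i, Fin (m i)} :
    (linearForest m).Adj a b ↔ a.1 = b.1 ∧ ((a.2 : ℕ) + 1 = b.2 ∨ (b.2 : ℕ) + 1 = a.2) := Iff.rfl

theorem sigma_fin_ext {ι : Type*} {m : ι → ℕ} {a b : Σ i, Fin (m i)} (h1 : a.1 = b.1)
    (h2 : (a.2 : ℕ) = b.2) : a = b := by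
  obtain ⟨i, x⟩ := a
  obtain ⟨j, y⟩ := b
  obtain rfl : i = j := h1
  exact congrArg (Sigma.mk i) (Fin.ext h2)

/-- The join of a single vertex and a disjoint union of paths. -/
abbrev cone {ι : Type*} (m : ι → ℕ) : SimpleGraph (Fin 1 ⊕ Σ i, Fin (m i)) :=
  join (⊤ : SimpleGraph (Fin 1)) (linearForest m)

section Join

variable {V W : Type*} {H : SimpleGraph V}

@[simp] theorem join_top_adj_inl_inl (a b : Fin 1) :
    ¬ (join (⊤ : SimpleGraph (Fin 1)) H).Adj (Sum.inl a) (Sum.inl b) := by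
  simp [join, Subsingleton.elim a b]

@[simp] theorem join_top_adj_inl_inr (a : Fin 1) (v : V) :
    (join (⊤ : SimpleGraph (Fin 1)) H).Adj (Sum.inl a) (Sum.inr v) := by simp [join]

@[simp] theorem join_top_adj_inr_inl (a : Fin 1) (v : V) :
    (join (⊤ : SimpleGraph (Fin 1)) H).Adj (Sum.inr v) (Sum.inl a) := by simp [join]

@[simp] theorem join_top_adj_inr_inr (v w : V) :
    (join (⊤ : SimpleGraph (Fin 1)) H).Adj (Sum.inr v) (Sum.inr w) ↔ H.Adj v w := by simp [join]

/-- Isomorphic graphs have isomorphic joins with a single vertex. -/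
def joinTopCongr {K : SimpleGraph W} (e : H ≃g K) :
    join (⊤ : SimpleGraph (Fin 1)) H ≃g join (⊤ : SimpleGraph (Fin 1)) K where
  toEquiv := Equiv.sumCongr (Equiv.refl _) e.toEquiv
  map_rel_iff' {a b} := by
    rcases a with a | a <;> rcases b with b | b <;> simp [e.map_adj_iff]

/-- A graph with a dominating vertex is the join of this vertex and the remaining graph. -/
theorem nonempty_iso_join_of_dominating {G : SimpleGraph V} {u : V}
    (hu : ∀ v, v ≠ u → G.Adj u v) :
    Nonempty (G ≃g join (⊤ : SimpleGraph (Fin 1)) (G.induce {v | v ≠ u})) := by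
  classical
  refine ⟨RelIso.symm ⟨⟨Sum.elim (fun _ => u) Subtype.val,
    fun v => if h : v = u then Sum.inl 0 else Sum.inr ⟨v, h⟩, ?_, ?_⟩, ?_⟩⟩
  · rintro (a | ⟨v, hv⟩)
    · simp [Subsingleton.elim a 0]
    · have hv' : v ≠ u := hv
      simp [hv']
  · intro v
    by_cases h : v = u <;> simp [h]
  · rintro (a | ⟨v, hv⟩) (b | ⟨w, hw⟩)
    · simp
    · simpa using hu w hw
    · simpa using (hu v hv).symm
    · simp

end Join

open Classical in
/-- A graph whose edges join consecutive elements of a finite linear order is a linear forest: the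
paths are the blocks between the pairs of consecutive elements that are not joined. -/
theorem exists_iso_linearForest {α : Type*} [LinearOrder α] [Fintype α] (H : SimpleGraph α)
    (hH : ∀ a b, H.Adj a b → a ⋖ b ∨ b ⋖ a) :
    ∃ (k : ℕ) (m : Fin k → ℕ), Nonempty (H ≃g linearForest m) := by
  -- `start c` says that a new block begins at `c`, and `b v` is the number of the block of `v`
  set start : α → Prop := fun c => ∀ a, a ⋖ c → ¬ H.Adj a c with hstart
  let b : α → Fin (Fintype.card α + 1) := fun v =>
    ⟨(Finset.univ.filter fun c => c ≤ v ∧ start c).card, Nat.lt_succ_of_le (Finset.card_le_univ _)⟩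
  have hmono : Monotone b := fun v w hvw => Finset.card_le_card fun c hc => by
    simp only [Finset.mem_filter, Finset.mem_univ, true_and] at hc ⊢
    exact ⟨hc.1.trans hvw, hc.2⟩
  have hb : ∀ {a c}, a ⋖ c → (H.Adj a c ↔ b a = b c) := by
    intro a c hac
    have hle : ∀ w, w ≤ c ↔ w = c ∨ w ≤ a := fun w => by
      rw [le_iff_lt_or_eq, or_comm]
      exact or_congr_right ⟨fun h => hac.le_of_lt h, fun h => h.trans_lt hac.lt⟩
    by_cases hs : start c
    · have h1 : (Finset.univ.filter fun w => w ≤ c ∧ start w) =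
          insert c (Finset.univ.filter fun w => w ≤ a ∧ start w) := by
        ext w
        simp only [Finset.mem_filter, Finset.mem_univ, true_and, Finset.mem_insert, hle]
        constructor
        · tauto
        · rintro (rfl | h) <;> tauto
      refine iff_of_false (hs a hac) fun he => ?_
      have h2 := congrArg Fin.val he
      simp only [b, h1] at h2
      rw [Finset.card_insert_of_notMem (by simp [hac.lt])] at h2
      omega
    · have h1 : (Finset.univ.filter fun w => w ≤ c ∧ start w) =
          Finset.univ.filter fun w => w ≤ a ∧ start w := by
        ext w
        simp only [Finset.mem_filter, Finset.mem_univ, true_and, hle]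
        constructor
        · rintro ⟨rfl | h, h'⟩ <;> tauto
        · tauto
      refine iff_of_true ?_ (Fin.ext (by simp only [b, h1]))
      simp only [hstart, not_forall, not_not] at hs
      obtain ⟨a', ha', h2⟩ := hs
      rwa [ha'.unique_left hac] at h2
  let e : ∀ i, Fin (Fintype.card {a // b a = i}) ≃o {a // b a = i} :=
    fun i => Fintype.orderIsoFinOfCardEq _ rfl
  have hcov : ∀ i j j', ((e i j).1 ⋖ (e i j').1) ↔ (j : ℕ) + 1 = j' := by
    intro i j j'
    have hconn : (Set.range (OrderEmbedding.subtype fun a => b a = i)).OrdConnected := by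
      refine ⟨?_⟩
      rintro _ ⟨x, rfl⟩ _ ⟨y, rfl⟩ z ⟨hz1, hz2⟩
      exact ⟨⟨z, le_antisymm ((hmono hz2).trans y.2.le) (x.2.ge.trans (hmono hz1))⟩, rfl⟩
    have h1 := hconn.apply_covBy_apply_iff _ (a := e i j) (b := e i j')
    simp only [OrderEmbedding.subtype_apply] at h1
    rw [h1, apply_covBy_apply_iff (e i), Fin.covBy_iff, Nat.covBy_iff_add_one_eq]
  refine ⟨_, fun i => Fintype.card {a // b a = i}, ⟨RelIso.symm ⟨(Equiv.sigmaCongrRight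
    fun i => (e i).toEquiv).trans (Equiv.sigmaFiberEquiv b), ?_⟩⟩⟩
  rintro ⟨i, j⟩ ⟨i', j'⟩
  change H.Adj (e i j).1 (e i' j').1 ↔ _
  rw [linearForest_adj]
  simp only
  have hbi : ∀ i j, b (e i j).1 = i := fun i j => (e i j).2
  constructor
  · intro h
    have hii : i = i' := by
      rcases hH _ _ h with h1 | h1
      · rw [← hbi i j, ← hbi i' j', (hb h1).1 h]
      · rw [← hbi i j, ← hbi i' j', (hb h1).1 h.symm]
    subst hii
    exact ⟨rfl, (hH _ _ h).imp (hcov _ _ _).1 (hcov _ _ _).1⟩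
  · rintro ⟨rfl, h | h⟩
    · exact (hb ((hcov _ _ _).2 h)).2 (by rw [hbi, hbi])
    · exact ((hb ((hcov _ _ _).2 h)).2 (by rw [hbi, hbi])).symm

/-- An outerplanar graph with a dominating vertex is the join of this vertex and a disjoint union
of paths: all other edges join vertices that are consecutive on the boundary circle. -/
theorem IsOuterplanar.exists_iso_cone {V : Type*} [Fintype V] {G : SimpleGraph V}
    (hG : IsOuterplanar G) {u : V} (hu : ∀ v, v ≠ u → G.Adj u v) :
    ∃ (k : ℕ) (m : Fin k → ℕ), Nonempty (G ≃g cone m) := by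
  classical
  obtain ⟨θ, hθ, hθu⟩ := hG.exists_nonCrossing u
  let _ : LinearOrder {v | v ≠ u} :=
    LinearOrder.lift' (fun v => θ v.1) (hθ.injective.comp Subtype.val_injective)
  have hcov : ∀ a b : {v | v ≠ u}, (G.induce {v | v ≠ u}).Adj a b → a < b → a ⋖ b := by
    intro a b hab hlt
    exact ⟨hlt, fun c hac hcb => hθ.not_adj a c b u hac hcb (hθu b b.2) hab (hu c c.2).symm⟩
  obtain ⟨k, m, ⟨e⟩⟩ := exists_iso_linearForest (G.induce {v | v ≠ u}) fun a b hab => by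
    rcases lt_or_gt_of_ne hab.ne with h | h
    · exact Or.inl (hcov a b hab h)
    · exact Or.inr (hcov b a hab.symm h)
  obtain ⟨e'⟩ := nonempty_iso_join_of_dominating hu
  exact ⟨k, m, ⟨e'.trans (joinTopCongr e)⟩⟩

theorem isOuterplanar_cone {k : ℕ} (m : Fin k → ℕ) : IsOuterplanar (cone m) := by
  -- the paths are laid out one after the other, and the vertex of the join is the last one
  let p : Fin 1 ⊕ (Σ i, Fin (m i)) → ℕ :=
    Sum.elim (fun _ => ∑ i, m i) fun a => (finSigmaFinEquiv a : ℕ)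
  have hlt : ∀ a, p (Sum.inr a) < p (Sum.inl 0) := fun a => (finSigmaFinEquiv a).2
  have hadj : ∀ {a b}, (linearForest m).Adj a b → (p (Sum.inr a) + 1 = p (Sum.inr b) ∨
      p (Sum.inr b) + 1 = p (Sum.inr a)) := by
    rintro ⟨i, x⟩ ⟨j, y⟩ ⟨hij, h⟩
    obtain rfl : i = j := hij
    simp only [p, Sum.elim_inr, finSigmaFinEquiv_apply] at h ⊢
    omega
  have hnc : NonCrossing (cone m) fun v => (p v : ℝ) := by
    refine ⟨?_, ?_⟩
    · rintro (a | a) (b | b) hab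
      · rw [Subsingleton.elim a b]
      · rw [Subsingleton.elim a 0] at hab
        exact absurd (Nat.cast_injective hab) (hlt b).ne'
      · rw [Subsingleton.elim b 0] at hab
        exact absurd (Nat.cast_injective hab) (hlt a).ne
      · rw [finSigmaFinEquiv.injective (Fin.ext (Nat.cast_injective hab))]
    · intro a b c d hab hbc hcd hac _
      simp only [Nat.cast_lt] at hab hbc hcd
      have hle : ∀ v, p v ≤ p (Sum.inl 0) := by
        rintro (v | v)
        · rw [Subsingleton.elim v 0]
        · exact (hlt v).le
      rcases c with c | c
      · rw [Subsingleton.elim c 0] at hcd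
        exact absurd hcd (not_lt.2 (hle d))
      · rcases a with a | a
        · rw [Subsingleton.elim a 0] at hab
          exact absurd hab (not_lt.2 (hle b))
        · rcases hadj ((join_top_adj_inr_inr a c).1 hac) with h | h <;> omega
  exact hnc.isOuterplanar

end OuterplanarSpectral

/-! ### Bouquets of cycles in cones -/

namespace OuterplanarSpectral

theorem cycleBouquet_adj_none {t l : ℕ} {i : Fin t} {j : Fin (l - 1)}
    (h : (j : ℕ) = 0 ∨ (j : ℕ) + 1 = l - 1) :
    (cycleBouquet t l).Adj none (some (i, j)) := by
  simp [cycleBouquet, h]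

theorem cycleBouquet_adj_some {t l : ℕ} {i : Fin t} {j j' : Fin (l - 1)}
    (h : (j : ℕ) + 1 = j') : (cycleBouquet t l).Adj (some (i, j)) (some (i, j')) := by
  have : j ≠ j' := by rintro rfl; omega
  simp [cycleBouquet, h, this]

theorem exists_two_neighbors_cycleBouquet {t l : ℕ} (hl : 3 ≤ l) (ht : 1 ≤ t)
    (p : Option (Fin t × Fin (l - 1))) :
    ∃ q q', q ≠ q' ∧ (cycleBouquet t l).Adj p q ∧ (cycleBouquet t l).Adj p q' := by
  rcases p with _ | ⟨i, j⟩
  · refine ⟨some (⟨0, ht⟩, ⟨0, by omega⟩), some (⟨0, ht⟩, ⟨l - 2, by omega⟩), ?_,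
      cycleBouquet_adj_none (Or.inl rfl), cycleBouquet_adj_none (Or.inr (by simp only; omega))⟩
    simp only [ne_eq, Option.some.injEq, Prod.mk.injEq, Fin.mk.injEq, true_and]
    omega
  · have hj := j.2
    by_cases h0 : (j : ℕ) = 0
    · refine ⟨none, some (i, ⟨j + 1, by omega⟩), by simp, (cycleBouquet_adj_none (Or.inl h0)).symm,
        cycleBouquet_adj_some rfl⟩
    · have h1 : (cycleBouquet t l).Adj (some (i, j)) (some (i, ⟨j - 1, by omega⟩)) :=
        (cycleBouquet_adj_some (by simp only; omega)).symm
      by_cases h2 : (j : ℕ) + 1 = l - 1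
      · exact ⟨none, _, by simp, (cycleBouquet_adj_none (Or.inr h2)).symm, h1⟩
      · refine ⟨some (i, ⟨j + 1, by omega⟩), _, ?_, cycleBouquet_adj_some rfl, h1⟩
        simp only [ne_eq, Option.some.injEq, Prod.mk.injEq, Fin.mk.injEq, true_and]
        omega

/-- A vertex of a path has at most three neighbours in the join with a single vertex. -/
theorem not_four_neighbors_cone {ι : Type*} {m : ι → ℕ} {z : Σ i, Fin (m i)}
    (w : Fin 4 → Fin 1 ⊕ Σ i, Fin (m i))
    (hw : Function.Injective w) : ¬ ∀ a, (cone m).Adj (Sum.inr z) (w a) := by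
  intro h
  let κ : (Fin 1 ⊕ Σ i, Fin (m i)) → Fin 3 :=
    Sum.elim (fun _ => 0) fun p => if (z.2 : ℕ) + 1 = p.2 then 1 else 2
  obtain ⟨a, b, hab, hκ⟩ := Fintype.exists_ne_map_eq_of_card_lt (fun a => κ (w a)) (by simp)
  refine hab (hw ?_)
  have ha := h a
  have hb := h b
  generalize w a = x at *
  generalize w b = y at *
  rcases x with x | x <;> rcases y with y | y
  · rw [Subsingleton.elim x y]
  · simp only [κ, Sum.elim_inl, Sum.elim_inr] at hκ
    split_ifs at hκ <;> simp at hκ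
  · simp only [κ, Sum.elim_inl, Sum.elim_inr] at hκ
    split_ifs at hκ <;> simp at hκ
  · obtain ⟨ha1, ha2⟩ := (join_top_adj_inr_inr _ _).1 ha
    obtain ⟨hb1, hb2⟩ := (join_top_adj_inr_inr _ _).1 hb
    simp only [κ, Sum.elim_inr] at hκ
    refine congrArg Sum.inr (sigma_fin_ext (ha1.symm.trans hb1) ?_)
    split_ifs at hκ <;> omega

variable {ι : Type*} [Fintype ι] {m : ι → ℕ}

/-- If `t` disjoint `s`-sets lie within components of a linear forest, then `t` is at most the
number of disjoint paths on `s` vertices that the components can hold. -/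
theorem le_sum_div_of_injective {t s : ℕ} (hs : 0 < s) (g : Fin t × Fin s → Σ i, Fin (m i))
    (hg : Function.Injective g) (hconst : ∀ a j j', (g (a, j)).1 = (g (a, j')).1) :
    t ≤ ∑ i, m i / s := by
  classical
  have h1 : t = ∑ i, (Finset.univ.filter fun a => (g (a, ⟨0, hs⟩)).1 = i).card := by
    have := Finset.card_eq_sum_card_fiberwise (s := (Finset.univ : Finset (Fin t)))
      (t := (Finset.univ : Finset ι)) (f := fun a => (g (a, ⟨0, hs⟩)).1) (fun _ _ => by simp)
    rwa [Finset.card_univ, Fintype.card_fin] at this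
  conv_lhs => rw [h1]
  refine Finset.sum_le_sum fun i _ => ?_
  rw [Nat.le_div_iff_mul_le hs]
  have h2 : (Finset.univ.image fun y => (⟨i, y⟩ : Σ i, Fin (m i))).card ≤ m i :=
    Finset.card_image_le.trans (by simp)
  refine le_trans ?_ h2
  have h3 := Finset.card_le_card_of_injOn
    (s := (Finset.univ.filter fun a => (g (a, ⟨0, hs⟩)).1 = i) ×ˢ (Finset.univ : Finset (Fin s)))
    (t := Finset.univ.image fun y => (⟨i, y⟩ : Σ i, Fin (m i))) g ?_ hg.injOn
  · simpa [Finset.card_product] using h3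
  · rintro ⟨a, j⟩ haj
    simp only [Finset.coe_product, Finset.coe_filter, Finset.mem_univ, true_and, Finset.coe_univ,
      Set.mem_prod, Set.mem_ofPred_eq, Set.mem_univ, and_true] at haj
    rw [hconst a ⟨0, hs⟩ j] at haj
    simp only [Finset.coe_image, Finset.coe_univ, Set.image_univ, Set.mem_range]
    rcases hgy : g (a, j) with ⟨i', y⟩
    rw [hgy] at haj
    obtain rfl : i' = i := haj
    exact ⟨y, rfl⟩

/-- The join of a vertex and a linear forest contains the bouquet of `t` cycles of length `l` if
the forest contains `t` disjoint paths on `l - 1` vertices. -/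
theorem isContained_cone {t l : ℕ} (hl : 3 ≤ l) (h : t ≤ ∑ i, m i / (l - 1)) :
    (cycleBouquet t l).IsContained (cone m) := by
  have hcard : Fintype.card (Fin t) ≤ Fintype.card (Σ i, Fin (m i / (l - 1))) := by simpa using h
  obtain ⟨e⟩ := Function.Embedding.nonempty_of_card_le hcard
  have hbound : ∀ a (j : Fin (l - 1)), ((e a).2 : ℕ) * (l - 1) + j < m (e a).1 := by
    intro a j
    have h1 : ((e a).2 : ℕ) + 1 ≤ m (e a).1 / (l - 1) := (e a).2.2
    have h2 := (Nat.le_div_iff_mul_le (by omega)).1 h1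
    have h3 := j.2
    rw [add_mul, one_mul] at h2
    omega
  let φ : Option (Fin t × Fin (l - 1)) → Fin 1 ⊕ Σ i, Fin (m i) := fun p =>
    p.elim (Sum.inl 0) fun p => Sum.inr ⟨(e p.1).1, ⟨_, hbound p.1 p.2⟩⟩
  have hadj : ∀ x y : Option (Fin t × Fin (l - 1)), x ≠ y →
      (match x, y with
        | none, some (_, j) => (j : ℕ) = 0 ∨ (j : ℕ) + 1 = l - 1
        | some (i, j), some (i', j') => i = i' ∧ (j : ℕ) + 1 = j'
        | _, _ => False) → (cone m).Adj (φ x) (φ y) := by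
    rintro (_ | ⟨i, j⟩) (_ | ⟨i', j'⟩) hne hxy
    · exact hxy.elim
    · exact join_top_adj_inl_inr _ _
    · exact hxy.elim
    · obtain ⟨rfl, hj⟩ := hxy
      exact (join_top_adj_inr_inr _ _).2 ⟨rfl, Or.inl (by simp only; omega)⟩
  refine ⟨⟨⟨φ, fun {x y} hxy => ?_⟩, ?_⟩⟩
  · obtain ⟨hne, h1 | h1⟩ := (SimpleGraph.fromRel_adj _ _ _).1 hxy
    · exact hadj x y hne h1
    · exact (hadj y x hne.symm h1).symm
  · rintro (_ | ⟨i, j⟩) (_ | ⟨i', j'⟩) hxy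
    · rfl
    · exact absurd hxy (by simp [φ])
    · exact absurd hxy (by simp [φ])
    · have hxy' : (⟨(e i).1, ⟨_, hbound i j⟩⟩ : Σ i, Fin (m i)) =
        ⟨(e i').1, ⟨_, hbound i' j'⟩⟩ := Sum.inr_injective hxy
      have h1 : (e i).1 = (e i').1 := congrArg (fun a : Σ i, Fin (m i) => a.1) hxy'
      have h2 : ((e i).2 : ℕ) * (l - 1) + j = (e i').2 * (l - 1) + j' :=
        congrArg (fun a : Σ i, Fin (m i) => (a.2 : ℕ)) hxy'
      have hl0 : 0 < l - 1 := by omega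
      have h3 : ((e i).2 : ℕ) = (e i').2 := by
        have := congrArg (· / (l - 1)) h2
        simpa [Nat.add_div_of_dvd_right, Nat.mul_div_cancel _ hl0, Nat.div_eq_of_lt j.2,
          Nat.div_eq_of_lt j'.2] using this
      have h4 : (j : ℕ) = j' := by rw [h3] at h2; omega
      have h5 : i = i' := e.injective (sigma_fin_ext h1 h3)
      rw [h5, Fin.ext h4]

/-- The converse of `isContained_cone`. If the vertex of the join is the centre of the bouquet or not
in the bouquet, then every cycle without the centre lies in one path of the forest. Otherwise the
degree of the centre forces `t = 1`, and the cycle without the vertex of the join is connected. -/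
theorem le_of_isContained_cone {t l : ℕ} (hl : 3 ≤ l) (ht : 1 ≤ t)
    (h : (cycleBouquet t l).IsContained (cone m)) : t ≤ ∑ i, m i / (l - 1) := by
  obtain ⟨f⟩ := h
  have hinl : ∀ {x y}, f x = Sum.inl 0 → f y ≠ Sum.inl 0 ∨ x = y := fun {x y} hx =>
    or_iff_not_imp_left.2 fun hy => f.injective (hx.trans (not_not.1 hy).symm)
  have hinr : ∀ {x}, f x ≠ Sum.inl 0 → ∃ a, f x = Sum.inr a := by
    intro x hx
    rcases hfx : f x with a | a
    · rw [hfx, Subsingleton.elim a 0] at hx; exact absurd rfl hx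
    · exact ⟨a, rfl⟩
  have hcomp : ∀ {x y a b}, (cycleBouquet t l).Adj x y → f x = Sum.inr a → f y = Sum.inr b →
      a.1 = b.1 := by
    intro x y a b hxy hx hy
    have := f.toHom.map_adj hxy
    change (cone m).Adj (f x) (f y) at this
    rw [hx, hy] at this
    exact ((join_top_adj_inr_inr _ _).1 this).1
  by_cases hcase : ∃ p, f (some p) = Sum.inl 0
  · obtain ⟨p₀, hp₀⟩ := hcase
    have hother : ∀ x, x ≠ some p₀ → ∃ a, f x = Sum.inr a := fun x hx =>
      hinr ((hinl hp₀).resolve_right (Ne.symm hx))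
    obtain ⟨z, hz⟩ := hother none (by simp)
    obtain rfl : t = 1 := by
      by_contra ht1
      have h2 : 2 ≤ t := by omega
      let q : Fin 4 → Fin t × Fin (l - 1) := ![(⟨0, ht⟩, ⟨0, by omega⟩),
        (⟨0, ht⟩, ⟨l - 2, by omega⟩), (⟨1, h2⟩, ⟨0, by omega⟩), (⟨1, h2⟩, ⟨l - 2, by omega⟩)]
      have hq : Function.Injective q := by
        intro a b hab
        fin_cases a <;> fin_cases b <;> simp [q] at hab ⊢ <;> omega
      refine not_four_neighbors_cone (z := z) (fun a => f (some (q a)))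
        (f.injective.comp ((Option.some_injective _).comp hq)) fun a => ?_
      rw [← hz]
      refine f.toHom.map_adj ?_
      fin_cases a
      · exact cycleBouquet_adj_none (Or.inl rfl)
      · exact cycleBouquet_adj_none (Or.inr (by simp; omega))
      · exact cycleBouquet_adj_none (Or.inl rfl)
      · exact cycleBouquet_adj_none (Or.inr (by simp; omega))
    obtain ⟨i₀, j₀⟩ := p₀
    -- the two arcs of the cycle between the centre and the vertex `j₀`
    have hup : ∀ j (hj : j < l - 1), j < j₀ → ∀ a, f (some (i₀, ⟨j, hj⟩)) = Sum.inr a →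
        a.1 = z.1 := by
      intro j
      induction j with
      | zero => exact fun hj _ a ha => (hcomp (cycleBouquet_adj_none (Or.inl rfl)) hz ha).symm
      | succ j ih =>
        intro hj hlt a ha
        obtain ⟨b, hb⟩ := hother (some (i₀, ⟨j, by omega⟩)) (by
          rintro h
          simp only [Option.some.injEq, Prod.mk.injEq, true_and] at h
          simp [← h] at hlt)
        rw [← ih _ (by omega) b hb]
        exact (hcomp (cycleBouquet_adj_some rfl) hb ha).symm
    have hdown : ∀ k j (hj : j < l - 1), j + k + 1 = l - 1 → j₀ < j →
        ∀ a, f (some (i₀, ⟨j, hj⟩)) = Sum.inr a → a.1 = z.1 := by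
      intro k
      induction k with
      | zero => exact fun j hj hk _ a ha =>
          (hcomp (cycleBouquet_adj_none (Or.inr (by simp only; omega))) hz ha).symm
      | succ k ih =>
        intro j hj hk hlt a ha
        obtain ⟨b, hb⟩ := hother (some (i₀, ⟨j + 1, by omega⟩)) (by
          rintro h
          simp only [Option.some.injEq, Prod.mk.injEq, true_and] at h
          simp [← h] at hlt)
        rw [← ih (j + 1) (by omega) (by omega) (by omega) b hb]
        exact hcomp (cycleBouquet_adj_some rfl) ha hb
    let x : Fin 1 × Fin (l - 1) → Option (Fin 1 × Fin (l - 1)) := fun p =>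
      if p = (i₀, j₀) then none else some p
    have hx : ∀ p, x p ≠ some (i₀, j₀) := fun p => by
      by_cases hp : p = (i₀, j₀) <;> simp [x, hp]
    choose g hg using fun p => hother (x p) (hx p)
    have hgz : ∀ p, (g p).1 = z.1 := by
      rintro ⟨i, j⟩
      obtain rfl := Subsingleton.elim i i₀
      have h1 := hg (i, j)
      rcases lt_trichotomy j j₀ with hlt | rfl | hlt
      · refine hup j j.2 hlt _ (by rw [← h1]; simp [x, hlt.ne])
      · simp only [x, if_true, hz] at h1
        rw [Sum.inr_injective h1]
      · refine hdown (l - 2 - j) j j.2 (by omega) hlt _ (by rw [← h1]; simp [x, hlt.ne'])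
    refine le_sum_div_of_injective (by omega) g ?_ fun a j j' => by rw [hgz, hgz]
    intro p p' hpp
    have h1 : x p = x p' := f.injective (by
      change f (x p) = f (x p')
      rw [hg, hg, hpp])
    by_cases hp : p = (i₀, j₀) <;> by_cases hp' : p' = (i₀, j₀) <;> simp [x, hp, hp'] at h1 ⊢
    exact h1
  · push Not at hcase
    choose g hg using fun p => hinr (hcase p)
    refine le_sum_div_of_injective (by omega) g
      (fun p p' hpp => Option.some_injective _ (f.injective (by
        change f (some p) = f (some p')
        rw [hg, hg, hpp]))) ?_
    have h0 : ∀ a j (hj : j < l - 1), (g (a, ⟨j, hj⟩)).1 = (g (a, ⟨0, by omega⟩)).1 := by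
      intro a j
      induction j with
      | zero => exact fun _ => rfl
      | succ j ih =>
        intro hj
        rw [← ih (by omega)]
        exact (hcomp (cycleBouquet_adj_some rfl) (hg _) (hg _)).symm
    intro a j j'
    rw [h0 a j j.2, h0 a j' j'.2]

theorem free_cone_iff {t l : ℕ} (hl : 3 ≤ l) (ht : 1 ≤ t) :
    (cycleBouquet t l).Free (cone m) ↔ ∑ i, m i / (l - 1) < t := by
  rw [← not_le, not_iff_not]
  exact ⟨le_of_isContained_cone hl ht, isContained_cone hl⟩

/-- Linear forests of the same order are isomorphic if the paths of one are matched with paths of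
the same length in the other; empty paths do not matter. -/
theorem nonempty_iso_linearForest {ι' : Type*} [Fintype ι'] {m' : ι' → ℕ} (σ : ι → ι')
    (hσ : ∀ i, m i ≠ 0 → m' (σ i) = m i)
    (hinj : ∀ i j, m i ≠ 0 → m j ≠ 0 → σ i = σ j → i = j) (hsum : ∑ i, m i = ∑ i, m' i) :
    Nonempty (linearForest m ≃g linearForest m') := by
  have hne : ∀ a : Σ i, Fin (m i), m a.1 ≠ 0 := fun a => by have := a.2.2; omega
  let φ : (Σ i, Fin (m i)) → Σ i, Fin (m' i) := fun a =>
    ⟨σ a.1, Fin.cast (hσ a.1 (hne a)).symm a.2⟩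
  have hφ : Function.Injective φ := by
    intro a b hab
    have h1 : σ a.1 = σ b.1 := congrArg Sigma.fst hab
    have h2 : (a.2 : ℕ) = b.2 := congrArg (fun c : Σ i, Fin (m' i) => (c.2 : ℕ)) hab
    exact sigma_fin_ext (hinj _ _ (hne a) (hne b) h1) h2
  have hbij : Function.Bijective φ := by
    rw [Fintype.bijective_iff_injective_and_card]
    exact ⟨hφ, by simpa using hsum⟩
  refine ⟨⟨Equiv.ofBijective φ hbij, fun {a b} => ?_⟩⟩
  change (linearForest m').Adj (φ a) (φ b) ↔ _
  rw [linearForest_adj, linearForest_adj]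
  exact and_congr_left fun _ => ⟨hinj _ _ (hne a) (hne b), congrArg σ⟩

/-- The orders of the paths in `graphHOP`. -/
def sizesHOP (n n₁ n₂ : ℕ) : (Unit ⊕ Fin ((n - 1 - n₁) / n₂)) ⊕ Unit → ℕ :=
  Sum.elim (Sum.elim (fun _ => n₁) fun _ => n₂) fun _ => (n - 1 - n₁) % n₂

theorem sum_sizesHOP {n n₁ n₂ : ℕ} (h : n₁ ≤ n - 1) : ∑ i, sizesHOP n n₁ n₂ i = n - 1 := by
  simp only [sizesHOP, Fintype.sum_sum_type, Sum.elim_inl, Sum.elim_inr, Finset.univ_unique,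
    Finset.sum_const, Finset.card_singleton, Finset.card_univ, Fintype.card_fin,
    smul_eq_mul]
  have := Nat.div_add_mod' (n - 1 - n₁) n₂
  omega

/-- `graphHOP` as a linear forest. -/
def isoHOP (n n₁ n₂ : ℕ) : linearForest (sizesHOP n n₁ n₂) ≃g graphHOP n n₁ n₂ where
  toFun
    | ⟨Sum.inl (Sum.inl _), j⟩ => Sum.inl (Sum.inl j)
    | ⟨Sum.inl (Sum.inr a), j⟩ => Sum.inl (Sum.inr (a, j))
    | ⟨Sum.inr _, j⟩ => Sum.inr j
  invFun
    | Sum.inl (Sum.inl j) => ⟨Sum.inl (Sum.inl ()), j⟩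
    | Sum.inl (Sum.inr (a, j)) => ⟨Sum.inl (Sum.inr a), j⟩
    | Sum.inr j => ⟨Sum.inr (), j⟩
  left_inv := by rintro ⟨(_ | a) | _, j⟩ <;> rfl
  right_inv := by rintro ((j | ⟨a, j⟩) | j) <;> rfl
  map_rel_iff' {x y} := by
    obtain ⟨(_ | a) | _, j⟩ := x <;> obtain ⟨(_ | a') | _, j'⟩ := y <;>
      simp [graphHOP, pathCopies, linearForest_adj, SimpleGraph.boxProd_adj]
    · exact SimpleGraph.pathGraph_adj
    · rw [and_comm]
      exact and_congr_right fun _ => SimpleGraph.pathGraph_adj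
    · exact SimpleGraph.pathGraph_adj

end OuterplanarSpectral

/-! ### The spectral radius of a cone -/

namespace OuterplanarSpectral

section Weights

variable {τ : ℝ}

/-- The solution of `(τ + τ⁻¹) * y k = 1 + y (k - 1) + y (k + 1)` for `1 ≤ k ≤ s` that vanishes for
`k = 0` and `k = s + 1`: the Perron weights of a path on `s` vertices when its vertices are all
joined to a vertex of weight `1` and the spectral radius is `τ + τ⁻¹`. -/
noncomputable def pathWeight (τ : ℝ) (s k : ℕ) : ℝ :=
  τ / (1 - τ) ^ 2 * (1 - (τ ^ k + τ ^ (s + 1 - k)) / (1 + τ ^ (s + 1)))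

/-- The part of the total weight of a path on `s` vertices that is not affine in `s`, up to a
constant factor. -/
noncomputable def pathGain (τ : ℝ) (s : ℕ) : ℝ := τ ^ s / (1 + τ ^ (s + 1))

theorem pathWeight_zero (h0 : 0 < τ) (s : ℕ) : pathWeight τ s 0 = 0 := by
  have : 1 + τ ^ (s + 1) ≠ 0 := by positivity
  rw [pathWeight, pow_zero, Nat.sub_zero, div_self this]; ring

theorem pathWeight_last (h0 : 0 < τ) (s : ℕ) : pathWeight τ s (s + 1) = 0 := by
  have : 1 + τ ^ (s + 1) ≠ 0 := by positivity
  rw [pathWeight, Nat.sub_self, pow_zero, add_comm, div_self this]; ring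

theorem pathWeight_recurrence (h0 : 0 < τ) (h1 : τ < 1) {s k : ℕ} (hk : k < s) :
    (τ + τ⁻¹) * pathWeight τ s (k + 1) = 1 + (pathWeight τ s k + pathWeight τ s (k + 2)) := by
  obtain ⟨d, rfl⟩ := Nat.exists_eq_add_of_lt hk
  have e1 : k + d + 1 + 1 - (k + 1) = d + 1 := by omega
  have e2 : k + d + 1 + 1 - k = d + 2 := by omega
  have e3 : k + d + 1 + 1 - (k + 2) = d := by omega
  simp only [pathWeight, e1, e2, e3]
  have hD : 1 + τ ^ (k + d + 1 + 1) ≠ 0 := by positivity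
  have hτ : 1 - τ ≠ 0 := by linarith
  generalize 1 + τ ^ (k + d + 1 + 1) = D at *
  have hc : (τ + τ⁻¹ - 2) * (τ / (1 - τ) ^ 2) = 1 := by field_simp; ring
  generalize τ / (1 - τ) ^ 2 = c at *
  have g : ∀ j, (τ + τ⁻¹) * τ ^ (j + 1) = τ ^ j + τ ^ (j + 2) := fun j => by
    field_simp; ring
  linear_combination hc - c / D * (g k + g d)

theorem sum_pathWeight (h0 : 0 < τ) (h1 : τ < 1) (s : ℕ) :
    ∑ j ∈ Finset.range s, pathWeight τ s (j + 1) = τ / (1 - τ) ^ 2 *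
      (s - 2 * τ / (1 - τ) + 2 * τ * (1 + τ) / (1 - τ) * pathGain τ s) := by
  have hD : 1 + τ ^ (s + 1) ≠ 0 := by positivity
  have hτ : 1 - τ ≠ 0 := by linarith
  have hτ' : τ - 1 ≠ 0 := by linarith
  have g1 : ∑ j ∈ Finset.range s, τ ^ (j + 1) = τ * (1 - τ ^ s) / (1 - τ) := by
    simp only [pow_succ, ← Finset.sum_mul]
    rw [geom_sum_eq h1.ne]; field_simp; ring
  have g2 : ∑ j ∈ Finset.range s, τ ^ (s + 1 - (j + 1)) = τ * (1 - τ ^ s) / (1 - τ) := by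
    rw [← g1, ← Finset.sum_range_reflect]
    refine Finset.sum_congr rfl fun j hj => ?_
    rw [Finset.mem_range] at hj
    congr 1; omega
  simp only [pathWeight, pathGain]
  rw [← Finset.mul_sum, Finset.sum_sub_distrib, ← Finset.sum_div, Finset.sum_add_distrib, g1, g2,
    Finset.sum_const, Finset.card_range, nsmul_eq_mul, mul_one]
  congr 1
  rw [pow_succ] at *
  field_simp
  ring

theorem pathGain_pos (h0 : 0 < τ) (s : ℕ) : 0 < pathGain τ s := by
  unfold pathGain; positivity

theorem two_mul_pathGain_succ_lt (h0 : 0 < τ) (h1 : τ < 1 / 3) (s : ℕ) :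
    2 * pathGain τ (s + 1) < pathGain τ s := by
  have hp : 0 < τ ^ s := by positivity
  have hp1 : τ ^ s ≤ 1 := pow_le_one₀ h0.le (by linarith)
  unfold pathGain
  rw [← mul_div_assoc, div_lt_div_iff₀ (by positivity) (by positivity)]
  have e : τ ^ (s + 1) = τ ^ s * τ := pow_succ _ _
  have e2 : τ ^ (s + 1 + 1) = τ ^ s * τ ^ 2 := by ring
  rw [e, e2]
  have h2 : 2 * τ * (1 + τ ^ s * τ) < 1 + τ ^ s * τ ^ 2 := by nlinarith
  nlinarith

theorem pathGain_strictAnti (h0 : 0 < τ) (h1 : τ < 1 / 3) : StrictAnti (pathGain τ) :=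
  strictAnti_nat_of_succ_lt fun s => by
    linarith [two_mul_pathGain_succ_lt h0 h1 s, pathGain_pos h0 (s + 1)]

/-- Moving `d` vertices from a shorter path to a longer one increases the gain. -/
theorem pathGain_shift (h0 : 0 < τ) (h1 : τ < 1 / 3) {a b d : ℕ} (hd : 1 ≤ d) (hdb : d ≤ b)
    (hab : b ≤ a) : pathGain τ a + pathGain τ b < pathGain τ (a + d) + pathGain τ (b - d) := by
  have hanti := (pathGain_strictAnti h0 h1).antitone
  have e1 : pathGain τ (b - d + 1) ≥ pathGain τ b := hanti (by omega)
  have e2 := hanti hab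
  linarith [two_mul_pathGain_succ_lt h0 h1 (b - d), pathGain_pos h0 (a + d)]

theorem exists_add_inv_eq {r : ℝ} (hr : 4 ≤ r) : ∃ τ : ℝ, 0 < τ ∧ τ < 1 / 3 ∧ τ + τ⁻¹ = r := by
  have hs : √(r ^ 2 - 4) ^ 2 = r ^ 2 - 4 := Real.sq_sqrt (by nlinarith)
  have hs2 : 2 < √(r ^ 2 - 4) := Real.lt_sqrt_of_sq_lt (by nlinarith)
  generalize √(r ^ 2 - 4) = s at *
  have hpos : 0 < r + s := by linarith
  refine ⟨2 / (r + s), by positivity, ?_, ?_⟩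
  · rw [div_lt_div_iff₀ hpos (by norm_num)]; linarith
  · field_simp
    linear_combination hs

end Weights

section Cone

variable {k : ℕ} {m : Fin k → ℕ} {τ : ℝ}

theorem neighborSum_join_inl {V : Type*} [Fintype V] (H : SimpleGraph V) (x : Fin 1 ⊕ V → ℝ) :
    neighborSum (join (⊤ : SimpleGraph (Fin 1)) H) x (Sum.inl 0) = ∑ v, x (Sum.inr v) := by
  classical
  rw [neighborSum_eq_sum_ite, Fintype.sum_sum_type]
  simp

theorem neighborSum_join_inr {V : Type*} [Fintype V] (H : SimpleGraph V) (x : Fin 1 ⊕ V → ℝ)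
    (v : V) : neighborSum (join (⊤ : SimpleGraph (Fin 1)) H) x (Sum.inr v) =
      x (Sum.inl 0) + neighborSum H (fun v => x (Sum.inr v)) v := by
  classical
  rw [neighborSum_eq_sum_ite, neighborSum_eq_sum_ite, Fintype.sum_sum_type]
  simp

/-- In a path the sum over the neighbours has two terms, if values beyond the ends vanish. -/
theorem neighborSum_linearForest {ι : Type*} [Fintype ι] {m : ι → ℕ} (y : ι → ℕ → ℝ)
    (hy0 : ∀ i, y i 0 = 0) (hy1 : ∀ i, y i (m i + 1) = 0) (a : Σ i, Fin (m i)) :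
    neighborSum (linearForest m) (fun a => y a.1 (a.2 + 1)) a = y a.1 a.2 + y a.1 (a.2 + 2) := by
  classical
  obtain ⟨i, j⟩ := a
  rw [neighborSum_eq_sum_ite, Fintype.sum_sigma, Finset.sum_eq_single i]
  · simp only [linearForest_adj, true_and]
    rw [Fin.sum_univ_eq_sum_range
      (fun j' => if (j : ℕ) + 1 = j' ∨ j' + 1 = j then y i (j' + 1) else 0) (m i)]
    have h1 : ∀ j' : ℕ, (if (j : ℕ) + 1 = j' ∨ j' + 1 = j then y i (j' + 1) else 0) =
        (if j' + 1 = (j : ℕ) then y i (j' + 1) else 0) +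
          if (j : ℕ) + 1 = j' then y i (j' + 1) else 0 := fun j' => by
      split_ifs <;> first | omega | simp
    simp only [h1]
    rw [Finset.sum_add_distrib, Finset.sum_ite_eq]
    congr 1
    · have hj := j.2
      generalize (j : ℕ) = p at *
      rcases p with _ | p
      · simp [hy0]
      · simp only [Nat.add_right_cancel_iff]
        rw [Finset.sum_ite_eq', if_pos (Finset.mem_range.2 (by omega))]
    · split_ifs with h
      · rfl
      · rw [show (j : ℕ) + 2 = m i + 1 by have := j.2; rw [Finset.mem_range] at h; omega, hy1]
  · intro i' _ hi
    exact Finset.sum_eq_zero fun j' _ => if_neg fun h => hi h.1.symm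
  · simp

/-- The vector that is `1` at the vertex of the join and satisfies the eigenvalue equation for
`τ + τ⁻¹` at all other vertices. -/
noncomputable def coneWeight (τ : ℝ) (m : Fin k → ℕ) : Fin 1 ⊕ (Σ i, Fin (m i)) → ℝ :=
  Sum.elim (fun _ => 1) fun a => pathWeight τ (m a.1) (a.2 + 1)

/-- The sum of `coneWeight` over the paths. -/
noncomputable def forestWeight (τ : ℝ) (m : Fin k → ℕ) : ℝ :=
  ∑ i, ∑ j ∈ Finset.range (m i), pathWeight τ (m i) (j + 1)

theorem neighborSum_coneWeight_inl :
    neighborSum (cone m) (coneWeight τ m) (Sum.inl 0) = forestWeight τ m := by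
  rw [neighborSum_join_inl, Fintype.sum_sigma]
  refine Finset.sum_congr rfl fun i _ => ?_
  exact Fin.sum_univ_eq_sum_range (fun j => pathWeight τ (m i) (j + 1)) (m i)

theorem neighborSum_coneWeight_inr (h0 : 0 < τ) (h1 : τ < 1) (a : Σ i, Fin (m i)) :
    neighborSum (cone m) (coneWeight τ m) (Sum.inr a) =
      (τ + τ⁻¹) * coneWeight τ m (Sum.inr a) := by
  rw [neighborSum_join_inr]
  have := neighborSum_linearForest (fun i => pathWeight τ (m i))
    (fun i => pathWeight_zero h0 (m i)) (fun i => pathWeight_last h0 (m i)) a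
  simp only [coneWeight, Sum.elim_inl, Sum.elim_inr] at this ⊢
  rw [this, pathWeight_recurrence h0 h1 a.2.2]

theorem sum_mul_neighborSum_coneWeight (h0 : 0 < τ) (h1 : τ < 1)
    (x : Fin 1 ⊕ (Σ i, Fin (m i)) → ℝ) :
    ∑ v, x v * neighborSum (cone m) (coneWeight τ m) v =
      (τ + τ⁻¹) * ∑ v, x v * coneWeight τ m v +
        (forestWeight τ m - (τ + τ⁻¹)) * x (Sum.inl 0) := by
  rw [Fintype.sum_sum_type, Fintype.sum_sum_type]
  simp only [Finset.univ_unique, Fin.default_eq_zero, Fin.isValue, Finset.sum_singleton,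
    neighborSum_coneWeight_inl, neighborSum_coneWeight_inr h0 h1]
  rw [mul_add, Finset.mul_sum]
  simp only [mul_left_comm (x _) (τ + τ⁻¹)]
  rw [show coneWeight τ m (Sum.inl 0) = 1 from rfl]
  ring

/-- The spectral radius `τ + τ⁻¹` of a cone is determined by the total weight of its paths. -/
theorem forestWeight_eq_of_rho_eq (h0 : 0 < τ) (h1 : τ < 1)
    (hrho : rho (cone m) = ENNReal.ofReal (τ + τ⁻¹)) : forestWeight τ m = τ + τ⁻¹ := by
  obtain ⟨r, x, hr0, hr, hx, hxne, heig, -⟩ := exists_perron_vector (cone m)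
  have hr' : r = τ + τ⁻¹ := by
    rw [hrho] at hr
    exact ((ENNReal.ofReal_eq_ofReal_iff (by positivity) hr0).1 hr).symm
  subst hr'
  have hpos : x (Sum.inl 0) ≠ 0 := by
    intro hzero
    have h2 := heig (Sum.inl 0)
    rw [neighborSum_join_inl, hzero, mul_zero,
      Finset.sum_eq_zero_iff_of_nonneg fun _ _ => hx _] at h2
    refine hxne (funext fun v => ?_)
    rcases v with v | v
    · rw [Subsingleton.elim v 0, hzero]; rfl
    · exact h2 v (Finset.mem_univ v)
  have h2 := sum_mul_neighborSum_coneWeight (m := m) h0 h1 x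
  rw [sum_mul_neighborSum_comm] at h2
  have h3 : ∑ v, coneWeight τ m v * neighborSum (cone m) x v =
      (τ + τ⁻¹) * ∑ v, x v * coneWeight τ m v := by
    rw [Finset.mul_sum]
    exact Finset.sum_congr rfl fun v _ => by rw [heig]; ring
  rw [h3] at h2
  have h4 : (forestWeight τ m - (τ + τ⁻¹)) * x (Sum.inl 0) = 0 := by linarith
  linarith [(mul_eq_zero.1 h4).resolve_right hpos]

theorem forestWeight_le_of_rho_le (h0 : 0 < τ) (h1 : τ < 1)
    (hrho : rho (cone m) ≤ ENNReal.ofReal (τ + τ⁻¹)) : forestWeight τ m ≤ τ + τ⁻¹ := by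
  obtain ⟨r, x, hr0, hr, -, -, -, hmax⟩ := exists_perron_vector (cone m)
  rw [hr, ENNReal.ofReal_le_ofReal_iff (by positivity)] at hrho
  have h2 := hmax (coneWeight τ m)
  rw [sum_mul_neighborSum_coneWeight h0 h1, show coneWeight τ m (Sum.inl 0) = 1 from rfl] at h2
  have h3 : r * ∑ v, coneWeight τ m v ^ 2 ≤ (τ + τ⁻¹) * ∑ v, coneWeight τ m v ^ 2 :=
    mul_le_mul_of_nonneg_right hrho (Finset.sum_nonneg fun _ _ => sq_nonneg _)
  simp only [← sq] at h2
  linarith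

/-- Among cones over linear forests of the same order and with the same number of (possibly empty)
paths, those of larger spectral radius have larger total gain. -/
theorem sum_pathGain_le_of_rho_le {m' : Fin k → ℕ} (h0 : 0 < τ) (h1 : τ < 1)
    (hrho : rho (cone m) = ENNReal.ofReal (τ + τ⁻¹)) (hle : rho (cone m') ≤ rho (cone m))
    (hsum : ∑ i, m' i = ∑ i, m i) : ∑ i, pathGain τ (m' i) ≤ ∑ i, pathGain τ (m i) := by
  have h2 := (forestWeight_le_of_rho_le h0 h1 (hle.trans hrho.le)).trans
    (forestWeight_eq_of_rho_eq h0 h1 hrho).ge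
  have h3 : 0 < 1 - τ := by linarith
  simp only [forestWeight, sum_pathWeight h0 h1, ← Finset.mul_sum, Finset.sum_add_distrib,
    Finset.sum_sub_distrib, ← Nat.cast_sum, hsum] at h2
  have h4 := le_of_mul_le_mul_left h2 (by positivity)
  exact le_of_mul_le_mul_left (by linarith)
    (show 0 < 2 * τ * (1 + τ) / (1 - τ) by positivity)

theorem sqrt_le_rho_cone : ENNReal.ofReal (√(∑ i, m i : ℕ)) ≤ rho (cone m) := by
  obtain ⟨r, x, hr0, hr, -, -, -, hmax⟩ := exists_perron_vector (cone m)
  rw [hr, ENNReal.ofReal_le_ofReal_iff hr0]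
  set N : ℝ := ((∑ i, m i : ℕ) : ℝ) with hN
  have hN0 : 0 ≤ N := Nat.cast_nonneg _
  have hsq : √N ^ 2 = N := Real.sq_sqrt hN0
  rcases eq_or_lt_of_le hN0 with h | hpos
  · rw [← h, Real.sqrt_zero]; exact hr0
  -- the Perron vector of the spanning star
  have h1 := hmax (Sum.elim (fun _ => √N) fun _ => 1)
  rw [Fintype.sum_sum_type, Fintype.sum_sum_type] at h1
  simp only [Finset.univ_unique, Fin.default_eq_zero, Fin.isValue, Finset.sum_singleton,
    neighborSum_join_inl, neighborSum_join_inr, Sum.elim_inl, Sum.elim_inr, one_mul, one_pow,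
    Finset.sum_add_distrib, Finset.sum_const, Finset.card_univ, Fintype.card_sigma,
    Fintype.card_fin, nsmul_eq_mul, mul_one] at h1
  have h2 : 0 ≤ ∑ a, neighborSum (linearForest m) (fun _ => 1) a :=
    Finset.sum_nonneg fun a _ => neighborSum_nonneg _ (fun _ => zero_le_one) a
  rw [← hN, hsq, Finset.card_singleton, Nat.cast_one, one_mul] at h1
  have h3 : √N * (2 * N) ≤ r * (2 * N) := by linarith
  exact le_of_mul_le_mul_right h3 (by positivity)

end Cone

/-- The optimisation over the orders of the paths: if no admissible transfer of vertices increases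
the gain, then one path has order `t * s - 1` and all others, up to one, have order `s - 1`. -/
theorem exists_sizes_of_optimal {τ : ℝ} (h0 : 0 < τ) (h1 : τ < 1 / 3) {k s t : ℕ} (hs : 0 < s)
    {m : Fin k → ℕ} (hadm : ∑ i, m i / s < t) (hlarge : t * s ≤ ∑ i, m i)
    (hopt : ∀ m' : Fin k → ℕ, ∑ i, m' i = ∑ i, m i → ∑ i, m' i / s < t →
      ∑ i, pathGain τ (m' i) ≤ ∑ i, pathGain τ (m i)) :
    ∃ i₀, m i₀ = t * s - 1 ∧ (∀ i, i ≠ i₀ → m i ≤ s - 1) ∧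
      ∀ i j, i ≠ i₀ → j ≠ i₀ → i ≠ j → m i ≠ 0 → m j ≠ 0 → m i = s - 1 ∨ m j = s - 1 := by
  have split : ∀ {M : Type} [AddCommMonoid M] (f : Fin k → M) {i j : Fin k}, i ≠ j →
      ∑ a, f a = (f i + f j) + ∑ a ∈ (Finset.univ.erase i).erase j, f a := by
    intro M _ f i j hij
    rw [add_assoc, Finset.add_sum_erase _ _ (by simp [hij.symm]),
      Finset.add_sum_erase _ _ (Finset.mem_univ i)]
  have shift : ∀ i j d, i ≠ j → 1 ≤ d → d ≤ m j → m j ≤ m i →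
      m i / s + m j / s + t ≤ ∑ a, m a / s + ((m i + d) / s + (m j - d) / s) := by
    intro i j d hij hd hdj hji
    by_contra! hlt
    let m' : Fin k → ℕ := Function.update (Function.update m i (m i + d)) j (m j - d)
    have hi : m' i = m i + d := by simp [m', hij]
    have hj : m' j = m j - d := by simp [m']
    have hrest : ∀ {M : Type} [AddCommMonoid M] (f : ℕ → M),
        ∑ a ∈ (Finset.univ.erase i).erase j, f (m' a) =
          ∑ a ∈ (Finset.univ.erase i).erase j, f (m a) := by
      intro M _ f
      refine Finset.sum_congr rfl fun a ha => ?_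
      simp only [Finset.mem_erase, Finset.mem_univ, and_true] at ha
      simp [m', ha.1, ha.2]
    have h2 := hopt m' (by
      rw [split m' hij, split m hij, hi, hj, hrest fun a => a]; omega) (by
      rw [split (fun a => m' a / s) hij, hi, hj, hrest fun a => a / s]
      rw [split (fun a => m a / s) hij] at hlt
      omega)
    rw [split (fun a => pathGain τ (m' a)) hij, split (fun a => pathGain τ (m a)) hij, hi, hj,
      hrest (pathGain τ)] at h2
    linarith [pathGain_shift h0 h1 hd hdj hji]
  have hlt : ∀ i j, i ≠ j → m j ≤ m i → m j < s := by
    intro i j hij hji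
    by_contra! hsj
    have h2 := shift i j s hij hs hsj hji
    rw [Nat.add_div_right _ hs] at h2
    have h3 : (m j - s) / s + 1 = m j / s := by
      rw [← Nat.add_div_right _ hs, Nat.sub_add_cancel hsj]
    omega
  have hmod : ∀ i j, i ≠ j → m j ≤ m i → m j ≠ 0 → s ∣ m i + 1 ∧ ∑ a, m a / s + 1 = t := by
    intro i j hij hji hj0
    have h2 := shift i j 1 hij le_rfl (by omega) hji
    rw [Nat.succ_div] at h2
    have h3 : (m j - 1) / s ≤ m j / s := Nat.div_le_div_right (by omega)
    split_ifs at h2 with hdvd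
    · exact ⟨hdvd, by omega⟩
    · omega
  have hk : Nonempty (Fin k) := by
    by_contra hempty
    rw [not_nonempty_iff] at hempty
    rw [Finset.univ_eq_empty, Finset.sum_empty] at hlarge hadm
    exact absurd (Nat.mul_pos hadm hs) (by omega)
  obtain ⟨i₀, hi₀⟩ := Finite.exists_max m
  have hsmall : ∀ i, i ≠ i₀ → m i < s := fun i hi => hlt i₀ i hi.symm (hi₀ i)
  have hsumdiv : ∑ a, m a / s = m i₀ / s :=
    Finset.sum_eq_single i₀ (fun i _ hi => Nat.div_eq_of_lt (hsmall i hi)) (by simp)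
  refine ⟨i₀, ?_, fun i hi => Nat.le_sub_one_of_lt (hsmall i hi), ?_⟩
  · obtain ⟨j, hj, hj0⟩ : ∃ j, j ≠ i₀ ∧ m j ≠ 0 := by
      by_contra! hall
      have h2 : ∑ i, m i = m i₀ := Finset.sum_eq_single i₀ (fun i _ hi => hall i hi) (by simp)
      rw [hsumdiv, Nat.div_lt_iff_lt_mul hs] at hadm
      omega
    obtain ⟨⟨c, hc⟩, h3⟩ := hmod i₀ j hj.symm (hi₀ j) hj0
    have h4 : (m i₀ + 1) / s = c := by rw [hc, Nat.mul_div_cancel_left _ hs]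
    rw [Nat.succ_div, if_pos ⟨c, hc⟩, ← hsumdiv, h3] at h4
    rw [h4, mul_comm]; omega
  · intro i j hi hj hij hi0 hj0
    have key : ∀ i j, i ≠ i₀ → i ≠ j → m j ≤ m i → m j ≠ 0 → m i = s - 1 := by
      intro i j hi hij hji hj0
      have h2 := Nat.le_of_dvd (Nat.succ_pos _) (hmod i j hij hji hj0).1
      have := hsmall i hi
      omega
    rcases le_total (m j) (m i) with h | h
    · exact Or.inl (key i j hi hij h hj0)
    · exact Or.inr (key j i hj hij.symm h hi0)

end OuterplanarSpectral

/-! ### Extremal graphs -/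

namespace OuterplanarSpectral

theorem IsOuterplanar.of_iso {V W : Type*} [Nonempty V] {G : SimpleGraph V} {H : SimpleGraph W}
    (hG : IsOuterplanar G) (e : H ≃g G) : IsOuterplanar H := by
  obtain ⟨u⟩ := ‹Nonempty V›
  obtain ⟨θ, hθ, -⟩ := hG.exists_nonCrossing u
  have hH : NonCrossing H fun v => θ (e v) :=
    ⟨hθ.injective.comp e.injective, fun a b c d h1 h2 h3 hac hbd =>
      hθ.not_adj _ _ _ _ h1 h2 h3 (e.map_adj_iff.2 hac) (e.map_adj_iff.2 hbd)⟩
  exact hH.isOuterplanar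

theorem free_of_iso {V W U : Type*} {F : SimpleGraph U} {G : SimpleGraph V} {H : SimpleGraph W}
    (hG : F.Free G) (e : H ≃g G) : F.Free H :=
  fun h => hG (h.trans ⟨e.toCopy⟩)

theorem rho_le_spexOP {V W : Type*} [Fintype V] [Nonempty V] {F : SimpleGraph W} {n : ℕ}
    (hn : Fintype.card V = n) {G : SimpleGraph V} (hG : IsOuterplanar G) (hF : F.Free G) :
    rho G ≤ spexOP n F := by
  have e := G.overFinIso hn
  rw [rho_congr e]
  exact le_iSup₂ (f := fun (G : SimpleGraph (Fin n)) (_ : G ∈ {G | IsOuterplanar G ∧ F.Free G}) =>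
    rho G) _ ⟨hG.of_iso e.symm, free_of_iso hF e.symm⟩

/-- The supremum that defines `spexOP` is attained, as there are finitely many graphs. -/
theorem extremalOP_nonempty {V W : Type*} [Fintype V] [Nonempty V] {F : SimpleGraph W} {n : ℕ}
    (hn : Fintype.card V = n) {G : SimpleGraph V} (hG : IsOuterplanar G) (hF : F.Free G) :
    (extremalOP n F).Nonempty := by
  have e := G.overFinIso hn
  have : Nonempty (Fin n) := ⟨e (Classical.arbitrary V)⟩
  obtain ⟨M, hM, hmax⟩ := Set.exists_max_image {G : SimpleGraph (Fin n) |
    IsOuterplanar G ∧ F.Free G} rho (Set.toFinite _)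
    ⟨_, hG.of_iso e.symm, free_of_iso hF e.symm⟩
  exact ⟨M, hM.1, hM.2, le_antisymm (rho_le_spexOP (V := Fin n) (by simp) hM.1 hM.2)
    (iSup₂_le hmax)⟩

/-- A linear forest with the optimal orders of paths is the graph `graphHOP`. -/
theorem nonempty_iso_graphHOP {n n₁ n₂ k : ℕ} (hn₁ : n₁ ≤ n - 1) (hn₂ : 0 < n₂) {m : Fin k → ℕ}
    (hsum : ∑ i, m i = n - 1) {i₀ : Fin k} (h₀ : m i₀ = n₁) (hle : ∀ i, i ≠ i₀ → m i ≤ n₂)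
    (huniq : ∀ i j, i ≠ i₀ → j ≠ i₀ → i ≠ j → m i ≠ 0 → m j ≠ 0 → m i = n₂ ∨ m j = n₂) :
    Nonempty (linearForest m ≃g graphHOP n n₁ n₂) := by
  classical
  set B := (Finset.univ.erase i₀).filter fun i => m i = n₂ with hB
  set C := (Finset.univ.erase i₀).filter fun i => ¬ m i = n₂ with hC
  have hmemB : ∀ {i}, i ∈ B ↔ i ≠ i₀ ∧ m i = n₂ := by simp [hB]
  have hmemC : ∀ {i}, i ∈ C ↔ i ≠ i₀ ∧ ¬ m i = n₂ := by simp [hC]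
  have htotal : n₁ + (B.card * n₂ + ∑ i ∈ C, m i) = n - 1 := by
    rw [← hsum, ← Finset.add_sum_erase _ _ (Finset.mem_univ i₀), h₀,
      ← Finset.sum_filter_add_sum_filter_not (Finset.univ.erase i₀) (fun i => m i = n₂), ← hB, ← hC,
      Finset.sum_congr rfl fun i hi => (hmemB.1 hi).2, Finset.sum_const, smul_eq_mul]
  -- at most one of the remaining paths is non-empty
  have hrest : ∀ i ∈ C, m i ≠ 0 → ∑ i ∈ C, m i = m i := fun i hi hi0 =>
    Finset.sum_eq_single i (fun j hj hji => by
      by_contra hj0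
      rcases huniq i j (hmemC.1 hi).1 (hmemC.1 hj).1 hji.symm hi0 hj0 with h | h
      · exact (hmemC.1 hi).2 h
      · exact (hmemC.1 hj).2 h) fun h => absurd hi h
  have hlt : ∑ i ∈ C, m i < n₂ := by
    by_cases h : ∃ i ∈ C, m i ≠ 0
    · obtain ⟨i, hi, hi0⟩ := h
      rw [hrest i hi hi0]
      exact lt_of_le_of_ne (hle i (hmemC.1 hi).1) (hmemC.1 hi).2
    · push Not at h
      rwa [Finset.sum_eq_zero h]
  have hdiv : n - 1 - n₁ = ∑ i ∈ C, m i + n₂ * B.card := by rw [mul_comm n₂]; omega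
  have hq : (n - 1 - n₁) / n₂ = B.card := by
    rw [hdiv, Nat.add_mul_div_left _ _ hn₂, Nat.div_eq_of_lt hlt, zero_add]
  have hr : (n - 1 - n₁) % n₂ = ∑ i ∈ C, m i := by
    rw [hdiv, Nat.add_mul_mod_self_left, Nat.mod_eq_of_lt hlt]
  let e : B ≃ Fin ((n - 1 - n₁) / n₂) := B.equivFin.trans (finCongr hq.symm)
  let σ : Fin k → (Unit ⊕ Fin ((n - 1 - n₁) / n₂)) ⊕ Unit := fun i =>
    if i = i₀ then Sum.inl (Sum.inl ()) else
      if h : i ∈ B then Sum.inl (Sum.inr (e ⟨i, h⟩)) else Sum.inr ()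
  have hCof : ∀ {i}, i ≠ i₀ → i ∉ B → i ∈ C := fun h h' =>
    hmemC.2 ⟨h, fun h2 => h' (hmemB.2 ⟨h, h2⟩)⟩
  have hσ : ∀ i, m i ≠ 0 → sizesHOP n n₁ n₂ (σ i) = m i := by
    intro i hi0
    by_cases hi : i = i₀
    · simp [σ, hi, sizesHOP, h₀]
    · by_cases hiB : i ∈ B
      · simp [σ, hi, hiB, sizesHOP, (hmemB.1 hiB).2]
      · simp [σ, hi, hiB, sizesHOP, hr, hrest i (hCof hi hiB) hi0]
  have hinj : ∀ i j, m i ≠ 0 → m j ≠ 0 → σ i = σ j → i = j := by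
    intro i j hi0 hj0 hij
    by_cases hi : i = i₀ <;> by_cases hj : j = i₀
    · rw [hi, hj]
    · by_cases hjB : j ∈ B <;> simp [σ, hi, hj, hjB] at hij
    · by_cases hiB : i ∈ B <;> simp [σ, hi, hj, hiB] at hij
    · by_cases hiB : i ∈ B <;> by_cases hjB : j ∈ B <;> simp [σ, hi, hj, hiB, hjB] at hij
      · exact hij
      · by_contra hne
        rcases huniq i j hi hj hne hi0 hj0 with h | h
        · exact hiB (hmemB.2 ⟨hi, h⟩)
        · exact hjB (hmemB.2 ⟨hj, h⟩)
  obtain ⟨f⟩ := nonempty_iso_linearForest σ hσ hinj (by rw [sum_sizesHOP hn₁, hsum])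
  exact ⟨f.trans (isoHOP n n₁ n₂)⟩

/-- Every extremal graph is the join of a vertex and the linear forest `graphHOP`. -/
theorem nonempty_iso_of_mem_extremalOP {l t n : ℕ} (hl : 3 ≤ l) (ht : 1 ≤ t)
    (hn : (1.27e7 : ℝ) ≤ n) (hlarge : t * (l - 1) + 1 ≤ n) {M : SimpleGraph (Fin n)}
    (hM : M ∈ extremalOP n (cycleBouquet t l)) :
    Nonempty (M ≃g join (⊤ : SimpleGraph (Fin 1)) (graphHOP n (t * l - t - 1) (l - 2))) := by
  obtain ⟨hMo, hMf, hMr⟩ := hM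
  have hcard : ∀ {k : ℕ} (m : Fin k → ℕ), ∑ i, m i = n - 1 →
      Fintype.card (Fin 1 ⊕ Σ i, Fin (m i)) = n := by
    intro k m hm
    simp only [Fintype.card_sum, Fintype.card_fin, Fintype.card_sigma, hm]
    omega
  have hupper : ∀ {k : ℕ} (m : Fin k → ℕ), ∑ i, m i = n - 1 → ∑ i, m i / (l - 1) < t →
      rho (cone m) ≤ rho M := fun m hm hmt => by
    rw [hMr]
    exact rho_le_spexOP (hcard m hm) (isOuterplanar_cone m) ((free_cone_iff hl ht).2 hmt)
  -- comparison with the star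
  have hsqrt : ENNReal.ofReal (√((n : ℝ) - 1)) ≤ rho M := by
    have h1 := hupper (fun _ : Fin (n - 1) => 1) (by simp)
      (by simp [Nat.div_eq_of_lt (show 1 < l - 1 by omega)]; omega)
    refine le_trans ?_ (sqrt_le_rho_cone.trans h1)
    rw [Finset.sum_const, Finset.card_univ, Fintype.card_fin, smul_eq_mul, mul_one,
      Nat.cast_sub (by omega), Nat.cast_one]
  rcases hMo.exists_dominating_or_reattach (by simpa using hn) (by simpa using hsqrt) with
    ⟨u, hu⟩ | ⟨u, v, ho, hlt⟩
  swap
  · have : Nonempty (Fin n) := ⟨u⟩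
    have h1 := rho_le_spexOP (n := n) (by simp) ho
      (free_reattach hMf (exists_two_neighbors_cycleBouquet hl ht) v u) (V := Fin n)
    rw [← hMr] at h1
    exact absurd hlt (not_lt.2 h1)
  obtain ⟨k, m, ⟨e⟩⟩ := hMo.exists_iso_cone hu
  have hsum : ∑ i, m i = n - 1 := by
    have := Fintype.card_congr e.toEquiv
    simp only [Fintype.card_sum, Fintype.card_fin, Fintype.card_sigma] at this
    omega
  have hadm := (free_cone_iff hl ht).1 (free_of_iso hMf e.symm)
  obtain ⟨r, x, hr0, hr, -, -, -, -⟩ := exists_perron_vector (cone m)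
  have hr4 : 4 ≤ r := by
    rw [rho_congr e, hr, ENNReal.ofReal_le_ofReal_iff hr0] at hsqrt
    refine le_trans (Real.le_sqrt_of_sq_le ?_) hsqrt
    have : (17 : ℝ) ≤ 1.27e7 := by norm_num
    linarith
  obtain ⟨τ, h0, h1, rfl⟩ := exists_add_inv_eq hr4
  have hl1 : t * (l - 1) - 1 = t * l - t - 1 := by rw [Nat.mul_sub_one]
  obtain ⟨i₀, hi₀, hle, huniq⟩ := exists_sizes_of_optimal h0 h1 (by omega) hadm (by omega)
    fun m' hm' hadm' => sum_pathGain_le_of_rho_le h0 (by linarith) hr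
      ((hupper m' (hm'.trans hsum) hadm').trans (rho_congr e).le) hm'
  obtain ⟨f⟩ := nonempty_iso_graphHOP (n := n) (n₂ := l - 2) (by omega) (by omega) hsum
    (hi₀.trans hl1) hle huniq
  exact ⟨e.trans (joinTopCongr f)⟩

end OuterplanarSpectral

theorem theorem2 (l t n : ℕ) (hl : 3 ≤ l) (ht : 1 ≤ t)
    (hn : max (1.27 * 10 ^ 7) (6.5025 * 2 ^ ((t - 1) * (l - 1) + l)) ≤ (n : ℝ)) :
    (t = 1 → ∀ G : SimpleGraph (Fin n),
      G ∈ OuterplanarSpectral.extremalOP n (OuterplanarSpectral.cycleBouquet t l) ↔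
        Nonempty (G ≃g OuterplanarSpectral.join (⊤ : SimpleGraph (Fin 1))
          (OuterplanarSpectral.graphHOP n (l - 2) (l - 2)))) ∧
    (2 ≤ t → ∀ G : SimpleGraph (Fin n),
      G ∈ OuterplanarSpectral.extremalOP n (OuterplanarSpectral.cycleBouquet t l) ↔
        Nonempty (G ≃g OuterplanarSpectral.join (⊤ : SimpleGraph (Fin 1))
          (OuterplanarSpectral.graphHOP n (t * l - t - 1) (l - 2)))) := by
  open OuterplanarSpectral in
  obtain ⟨hn1, hn2⟩ := max_le_iff.1 hn
  have hn1' : (1.27e7 : ℝ) ≤ n := by norm_num at hn1 ⊢; exact hn1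
  have hlarge : t * (l - 1) + 1 ≤ n := by
    have h1 : (t - 1) * (l - 1) + l < 2 ^ ((t - 1) * (l - 1) + l) := Nat.lt_two_pow_self
    have h2 : ((2 ^ ((t - 1) * (l - 1) + l) : ℕ) : ℝ) ≤ n := by
      push_cast
      have : (0 : ℝ) < 2 ^ ((t - 1) * (l - 1) + l) := by positivity
      linarith
    have h3 : t * (l - 1) + 1 = (t - 1) * (l - 1) + l := by
      obtain ⟨t, rfl⟩ := Nat.exists_eq_add_of_le' ht
      rw [Nat.add_sub_cancel, add_mul, one_mul]
      omega
    have h4 : 2 ^ ((t - 1) * (l - 1) + l) ≤ n := by exact_mod_cast h2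
    omega
  have hchar : ∀ G : SimpleGraph (Fin n), G ∈ extremalOP n (cycleBouquet t l) ↔
      Nonempty (G ≃g join (⊤ : SimpleGraph (Fin 1)) (graphHOP n (t * l - t - 1) (l - 2))) := by
    intro G
    have hpos : Nonempty (Fin n) := ⟨⟨0, by omega⟩⟩
    refine ⟨nonempty_iso_of_mem_extremalOP hl ht hn1' hlarge, fun ⟨e⟩ => ?_⟩
    -- an extremal graph exists, and `G` is isomorphic to it
    obtain ⟨M, hM⟩ := extremalOP_nonempty (F := cycleBouquet t l)
      (V := Fin 1 ⊕ Σ i : Fin (n - 1), Fin ((fun _ => 1) i))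
      (n := n) (by simp; omega) (isOuterplanar_cone fun _ => 1) ((free_cone_iff hl ht).2
        (by simp [Nat.div_eq_of_lt (show 1 < l - 1 by omega)]; omega))
    obtain ⟨e'⟩ := nonempty_iso_of_mem_extremalOP hl ht hn1' hlarge hM
    have f : G ≃g M := e.trans e'.symm
    exact ⟨hM.1.of_iso f, free_of_iso hM.2.1 f, (rho_congr f).trans hM.2.2⟩
  refine ⟨?_, fun _ => hchar⟩
  rintro rfl
  rwa [one_mul, show l - 1 - 1 = l - 2 by omega] at hchar
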